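/- **Conventions.** The dimension of a poset $(S,\le)$ is the least number $k$ of linear orders on $S$ whose intersection is $\le$. A comparability graph is a graph that has a transitive orientation, i.e. a partial order on its vertices such that two distinct vertices are adjacent if and only if they are comparable. Its dimension is the dimension of its transitive orientations (all transitive orientations of a finite graph have the same dimension). For a graph $X$ let $Y$ be its incidence graph, i.e. the bipartite graph on $V(X)\cup E(X)$ in which $x\in V(X)$ and $e\in E(X)$ are adjacent if and only if $x\in e$. For a graph $Z$ let $C_Z$ be the graph with a vertex $p_z$ for every vertex $z$, a vertex $r_e$ for every edge $e$ and a vertex $q_{z,e}$ for every incidence $z\in e$ of $Z$, and with the edges $p_zq_{z,e}$ and $q_{z,e}r_e$ (every edge of $Z$ is replaced by a path of length four). Let $P_Z$ be the poset on $V(C_Z)$ with the strict relations $p_z<q_{z,e}$ and $r_e<q_{z,e}$; it is a transitive orientation of $C_Z$. The isomorphism problem for comparability graphs (posets) of dimension at most $k$ asks, for two given finite comparability graphs (posets) that are promised to have dimension at most $k$, whether they are isomorphic. Graphs are given by the number of vertices and the list of edges, posets by the number of elements and the list of the pairs $a<b$, with all numbers in unary. A problem is GI-complete if the isomorphism problem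 for all finite graphs reduces to it, and it reduces to that problem, by polynomial-time many-one reductions. **Theorem.** Let $k\ge 4$. 1. For every finite group $G$ there is a finite comparability graph $X$ of dimension at most $k$ (in particular, for $k=4$, of dimension at most $4$) with $\mathrm{Aut}(X)\cong G$, which moreover has a transitive orientation that is a poset $P$ of dimension at most $k$ with $\mathrm{Aut}(P)\cong G$. 2. The isomorphism problem for comparability graphs of dimension at most $k$ is GI-complete, and so is the isomorphism problem for posets of dimension at most $k$. 3. The construction $X\mapsto C_Y$ gives a polynomial-time reduction $(X_1,X_2)\mapsto(C_{Y_1},C_{Y_2})$ of the isomorphism problem for all finite graphs to the one for comparability graphs of dimension at most $k$: it can be computed in polynomial time (up to the numbering of the vertices), every $C_Y$ is a comparability graph of dimension at most $4$, and $X_1\cong X_2$ if and only if $C_{Y_1}\cong C_{Y_2}$. In the same way $(X_1,X_2)\mapsto(P_{Y_1},P_{Y_2})$ is a polynomial-time reduction to the isomorphism problem for posets of dimension at most $k$. -/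

import Mathlib

/-! Order dimension, comparability graphs and their dimension, the graph that replaces every edge
by a path of length four, and isomorphism problems with polynomial-time reductions. -/

namespace KDim

universe u

section Dimension

/-- The order of `α` is the intersection of `k` linear orders. -/
def HasRealizer (α : Type u) [PartialOrder α] (k : ℕ) : Prop :=
  ∃ L : Fin k → LinearOrder α, ∀ x y : α, x ≤ y ↔ ∀ i, (L i).le x y

/-- The (Dushnik-Miller) dimension of a poset: the least number of linear orders whose intersection
is the given order (`⊤` if there is no finite such family). -/
noncomputable def orderDim (α : Type u) [PartialOrder α] : ℕ∞ :=
  ⨅ (k : ℕ) (_ : HasRealizer α k), (k : ℕ∞)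

/-- `P` is a transitive orientation of the graph `X`: a strict partial order that orients precisely
the edges of `X`. -/
def IsTransitiveOrientation {V : Type u} (X : SimpleGraph V) (P : PartialOrder V) : Prop :=
  ∀ x y : V, X.Adj x y ↔ (P.lt x y ∨ P.lt y x)

/-- A comparability graph is a graph that has a transitive orientation. -/
def IsComparabilityGraph {V : Type u} (X : SimpleGraph V) : Prop :=
  ∃ P : PartialOrder V, IsTransitiveOrientation X P

/-- The dimension of a comparability graph is the dimension of its transitive orientations. (All
transitive orientations of a finite graph have the same dimension, so that the infimum below is
this common value.) -/
noncomputable def graphDim {V : Type u} (X : SimpleGraph V) : ℕ∞ :=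
  ⨅ (P : PartialOrder V) (_ : IsTransitiveOrientation X P), @orderDim V P

/-- `X` belongs to the class of comparability graphs of dimension at most `k`. -/
def InDim (k : ℕ) {V : Type u} (X : SimpleGraph V) : Prop :=
  IsComparabilityGraph X ∧ graphDim X ≤ k

end Dimension

section Construction

variable {V : Type u}

/-- The adjacency relation of the incidence graph: a vertex is adjacent to the edges through it. -/
def incidenceAdj (X : SimpleGraph V) : V ⊕ X.edgeSet → V ⊕ X.edgeSet → Prop
  | Sum.inl v, Sum.inr e => v ∈ (e : Sym2 V)
  | Sum.inr e, Sum.inl v => v ∈ (e : Sym2 V)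
  | _, _ => False

/-- The bipartite incidence graph between the vertices and the edges of `X`. -/
def incidenceGraph (X : SimpleGraph V) : SimpleGraph (V ⊕ X.edgeSet) where
  Adj := incidenceAdj X
  symm := ⟨by rintro (v | e) (w | f) h <;> exact h⟩
  loopless := ⟨by rintro (v | e) h <;> exact h⟩

/-- The vertices of the graph `C_X`: a vertex `p` for every vertex of `X`, a vertex `q` for every
incidence of a vertex of `X` with an edge of `X`, and a vertex `r` for every edge of `X`. -/
inductive PathVert (X : SimpleGraph V) : Type u
  | p (v : V) : PathVert X
  | q (v : V) (e : X.edgeSet) (h : v ∈ (e : Sym2 V)) : PathVert X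
  | r (e : X.edgeSet) : PathVert X

/-- The pairs `p_v < q_{v,e}` and `r_e < q_{v,e}`, for all incidences of `v` and `e`. -/
inductive PathLt (X : SimpleGraph V) : PathVert X → PathVert X → Prop
  | pq (v : V) (e : X.edgeSet) (h : v ∈ (e : Sym2 V)) : PathLt X (.p v) (.q v e h)
  | rq (v : V) (e : X.edgeSet) (h : v ∈ (e : Sym2 V)) : PathLt X (.r e) (.q v e h)

theorem PathLt.not_trans {X : SimpleGraph V} {a b c : PathVert X} (h : PathLt X a b)
    (h' : PathLt X b c) : False := by
  cases h <;> cases h'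

/-- The graph `C_X`, with the edges `p_v q_{v,e}` and `q_{v,e} r_e`; it arises from `X` by replacing
every edge by a path of length four. -/
def edgePathGraph (X : SimpleGraph V) : SimpleGraph (PathVert X) where
  Adj a b := PathLt X a b ∨ PathLt X b a
  symm := ⟨fun _ _ h => h.symm⟩
  loopless := ⟨fun _ h => h.elim (fun h => h.not_trans h) (fun h => h.not_trans h)⟩

/-- The poset `P_X`: the transitive orientation of `C_X` in which the vertices `p` and `r` are
minimal. -/
instance edgePathOrder (X : SimpleGraph V) : PartialOrder (PathVert X) where
  le a b := a = b ∨ PathLt X a b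
  lt a b := PathLt X a b
  le_refl a := Or.inl rfl
  le_trans a b c := by
    rintro (rfl | h) (rfl | h')
    · exact Or.inl rfl
    · exact Or.inr h'
    · exact Or.inr h
    · exact (h.not_trans h').elim
  le_antisymm a b := by
    rintro (rfl | h) (h' | h')
    · rfl
    · rfl
    · exact h'.symm
    · exact (h.not_trans h').elim
  lt_iff_le_not_ge a b := by
    constructor
    · intro h
      refine ⟨Or.inr h, ?_⟩
      rintro (rfl | h')
      · exact h.not_trans h
      · exact h.not_trans h'
    · rintro ⟨rfl | h, h'⟩
      · exact (h' (Or.inl rfl)).elim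
      · exact h

end Construction

section Codes

/-- A finite graph in the form in which it is handed to a machine: a number `n` of vertices
`0, …, n - 1` and a list of the edges, without loops, in which every edge occurs once. -/
structure GraphCode where
  n : ℕ
  edges : List (ℕ × ℕ)
  bound : ∀ e ∈ edges, e.1 < n ∧ e.2 < n
  loopless : ∀ e ∈ edges, e.1 ≠ e.2
  oneDirection : ∀ e ∈ edges, (e.2, e.1) ∉ edges
  nodup : edges.Nodup

/-- The graph described by a code. -/
def GraphCode.graph (c : GraphCode) : SimpleGraph (Fin c.n) where
  Adj a b := ((a : ℕ), (b : ℕ)) ∈ c.edges ∨ ((b : ℕ), (a : ℕ)) ∈ c.edges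
  symm := ⟨fun _ _ h => h.symm⟩
  loopless := ⟨fun _ h => h.elim (fun h => c.loopless _ h rfl) (fun h => c.loopless _ h rfl)⟩

/-- A finite poset in the form in which it is handed to a machine: a number `n` of elements
`0, …, n - 1` and a list of the pairs of its strict order, in which every pair occurs once. -/
structure PosetCode where
  n : ℕ
  pairs : List (ℕ × ℕ)
  bound : ∀ e ∈ pairs, e.1 < n ∧ e.2 < n
  irrefl : ∀ e ∈ pairs, e.1 ≠ e.2
  trans : ∀ a b c : ℕ, (a, b) ∈ pairs → (b, c) ∈ pairs → (a, c) ∈ pairs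
  nodup : pairs.Nodup

/-- The elements of the poset described by a code (a copy of `Fin n`, with its own order). -/
def PosetCode.Carrier (c : PosetCode) : Type := Fin c.n

/-- The strict order described by a code. -/
def PosetCode.Lt (c : PosetCode) (a b : c.Carrier) : Prop :=
  (Fin.val (n := c.n) a, Fin.val (n := c.n) b) ∈ c.pairs

theorem PosetCode.Lt.trans {c : PosetCode} {a b d : c.Carrier} (h : c.Lt a b) (h' : c.Lt b d) :
    c.Lt a d :=
  c.trans _ _ _ h h'

theorem PosetCode.Lt.irrefl {c : PosetCode} {a : c.Carrier} (h : c.Lt a a) : False :=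
  c.irrefl _ h rfl

instance PosetCode.partialOrder (c : PosetCode) : PartialOrder c.Carrier where
  le a b := a = b ∨ c.Lt a b
  lt a b := c.Lt a b
  le_refl a := Or.inl rfl
  le_trans a b d := by
    rintro (rfl | h) (rfl | h')
    · exact Or.inl rfl
    · exact Or.inr h'
    · exact Or.inr h
    · exact Or.inr (h.trans h')
  le_antisymm a b := by
    rintro (rfl | h) (h' | h')
    · rfl
    · rfl
    · exact h'.symm
    · exact (h.trans h').irrefl.elim
  lt_iff_le_not_ge a b := by
    constructor
    · intro h
      refine ⟨Or.inr h, ?_⟩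
      rintro (rfl | h')
      · exact h.irrefl
      · exact (h.trans h').irrefl
    · rintro ⟨rfl | h, h'⟩
      · exact (h' (Or.inl rfl)).elim
      · exact h

/-- The alphabet of the encodings: a tick for unary numbers, a separator and an end mark. -/
inductive Letter : Type
  | tick
  | bar
  | finish
  deriving DecidableEq

instance : Fintype Letter where
  elems := {Letter.tick, Letter.bar, Letter.finish}
  complete x := by cases x <;> simp

/-- The word `1ⁿ | 1ᵃ | 1ᵇ | 1ᶜ | 1ᵈ ⋯ finish` for the number `n` and the pairs `(a, b), (c, d), …`. -/
def encodeData (n : ℕ) (l : List (ℕ × ℕ)) : List Letter :=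
  List.replicate n Letter.tick ++
    l.flatMap (fun e => Letter.bar :: List.replicate e.1 Letter.tick ++
      (Letter.bar :: List.replicate e.2 Letter.tick)) ++ [Letter.finish]

/-- The word for a pair of graphs. -/
def encodeGraphs (I : GraphCode × GraphCode) : List Letter :=
  encodeData I.1.n I.1.edges ++ encodeData I.2.n I.2.edges

/-- The word for a pair of posets. -/
def encodePosets (I : PosetCode × PosetCode) : List Letter :=
  encodeData I.1.n I.1.pairs ++ encodeData I.2.n I.2.pairs

end Codes

section Problems

/-- A decision problem with a promise: the question `yes` is posed for the encoded instances that
satisfy `promise`. -/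
structure PromiseProblem where
  Inst : Type
  encode : Inst → List Letter
  promise : Inst → Prop
  yes : Inst → Prop

/-- `f` is a polynomial-time many-one (Karp) reduction of `P` to `Q`. -/
def IsPolyReduction (P Q : PromiseProblem) (f : P.Inst → Q.Inst) : Prop :=
  Nonempty (Turing.TM2ComputableInPolyTime P.encode Q.encode f) ∧
    ∀ I, P.promise I → Q.promise (f I) ∧ (P.yes I ↔ Q.yes (f I))

/-- `P` is polynomial-time many-one reducible to `Q`. -/
def PolyReduces (P Q : PromiseProblem) : Prop :=
  ∃ f : P.Inst → Q.Inst, IsPolyReduction P Q f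

/-- The graph isomorphism problem for all finite graphs. -/
def graphIso : PromiseProblem where
  Inst := GraphCode × GraphCode
  encode := encodeGraphs
  promise _ := True
  yes I := Nonempty (I.1.graph ≃g I.2.graph)

/-- The graph isomorphism problem for comparability graphs of dimension at most `k`. -/
def graphIsoDim (k : ℕ) : PromiseProblem where
  Inst := GraphCode × GraphCode
  encode := encodeGraphs
  promise I := InDim k I.1.graph ∧ InDim k I.2.graph
  yes I := Nonempty (I.1.graph ≃g I.2.graph)

/-- The isomorphism problem for posets of dimension at most `k`. -/
def posetIsoDim (k : ℕ) : PromiseProblem where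
  Inst := PosetCode × PosetCode
  encode := encodePosets
  promise I := orderDim I.1.Carrier ≤ k ∧ orderDim I.2.Carrier ≤ k
  yes I := Nonempty (I.1.Carrier ≃o I.2.Carrier)

/-- A problem is GI-complete if it is polynomial-time equivalent to graph isomorphism. -/
def GIComplete (P : PromiseProblem) : Prop :=
  PolyReduces graphIso P ∧ PolyReduces P graphIso

end Problems

end KDim

/-! Every poset `P_X` of a finite graph has dimension at most 4. In one linear order all `p` come
first and `q_{v,e}` closely follows `r_e`; in another all `r` come first and `q_{v,e}` closely
follows `p_v`; and both are taken a second time with the numberings of vertices and edges reversed.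
Every incomparable pair then occurs in both directions (`hasRealizer_pathVert`). So it suffices that
`X ↦ C_X` loses neither symmetries nor isomorphism types.

Universality: in `C_X` all `q` and `r` have degree two, while `p_v` has the degree of `v`. If `X`
has no vertex of degree two, the `p` are recognizable and every automorphism of `C_X` comes from `X`
(`exists_pathMap_eq`). A graph of this kind with a prescribed finite automorphism group is a
coloured Cayley graph whose colours are encoded by rigid attachments (`fruchtHom_bijective`).

Hardness: `C_X` is the incidence graph of the incidence graph of `X`, so everything rests on the
fact that a finite graph is determined by its incidence graph (`nonempty_iso_of_incidenceGraph`). An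
isomorphism of incidence graphs can exchange vertices and edges only where the vertices have degree
two; there the incidences form a 2-regular relation, and a perfect matching in it turns the
exchanged vertices back into edges. For the incidence graph `Y` of `X`, `C_Y` replaces each edge of
`X` by a path of length eight.

Conversely, the graph problem is a restriction of graph isomorphism, and a poset is encoded in a
graph by gluing a complete graph on four vertices asymmetrically to each pair `a < b`
(`lt_iff_cliqueGraph`).

Both nontrivial reductions replace the listed pairs by copies of a fixed gadget. One stack machine,
with the gadget as a parameter, does this in polynomial time (`program.computable`). -/

namespace KDim

/-! ### Stack machines with simple instructions, and their compilation to `TM2` -/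

section Machine

/-- The stacks of the gadget machine. -/
inductive Stack : Type
  | inp | out | save | a | b | c | tmp
  deriving DecidableEq

instance : Fintype Stack where
  elems := {.inp, .out, .save, .a, .b, .c, .tmp}
  complete x := by cases x <;> simp

/-- The contents of the stacks of the gadget machine. -/
structure Regs where
  inp : List Letter
  out : List Letter
  save : List Letter
  a : List Letter
  b : List Letter
  c : List Letter
  tmp : List Letter

def Regs.get (R : Regs) : Stack → List Letter
  | .inp => R.inp
  | .out => R.out
  | .save => R.save
  | .a => R.a
  | .b => R.b
  | .c => R.c
  | .tmp => R.tmp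

def Regs.set (R : Regs) (k : Stack) (w : List Letter) : Regs :=
  match k with
  | .inp => { R with inp := w }
  | .out => { R with out := w }
  | .save => { R with save := w }
  | .a => { R with a := w }
  | .b => { R with b := w }
  | .c => { R with c := w }
  | .tmp => { R with tmp := w }

theorem Regs.update_get (R : Regs) (k : Stack) (w : List Letter) :
    Function.update R.get k w = (R.set k w).get := by
  funext j
  cases k <;> cases j <;> rfl

def Regs.push (R : Regs) (x : Stack × Letter) : Regs := R.set x.1 (x.2 :: R.get x.1)

/-- A machine each of whose instructions pops a letter from a stack and then, depending on that
letter, pushes some letters and jumps (or halts). -/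
structure PopMachine (L : Type) where
  src : L → Stack
  act : L → Option Letter → List (Stack × Letter) × Option L

namespace PopMachine

variable {L : Type} (M : PopMachine L)

/-- The effect of the instruction `l`. -/
def next (l : L) (R : Regs) : Option L × Regs :=
  let x := M.act l (R.get (M.src l)).head?
  (x.2, x.1.foldl Regs.push (R.set (M.src l) (R.get (M.src l)).tail))

/-- `M` gets from one configuration to another one in at most the given number of steps. -/
inductive Within : ℕ → Option L × Regs → Option L × Regs → Prop
  | refl (n : ℕ) (x : Option L × Regs) : Within n x x
  | head {n : ℕ} {l : L} {R : Regs} {z : Option L × Regs} :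
      Within n (M.next l R) z → Within (n + 1) (some l, R) z

variable {M}

theorem Within.mono {m n : ℕ} {x y : Option L × Regs} (h : M.Within m x y) (hmn : m ≤ n) :
    M.Within n x y := by
  induction h generalizing n with
  | refl => exact .refl _ _
  | head _ ih =>
    obtain ⟨k, rfl⟩ : ∃ k, n = k + 1 := ⟨n - 1, by omega⟩
    exact .head (ih (by omega))

theorem Within.trans {m n : ℕ} {x y z : Option L × Regs} (h : M.Within m x y)
    (h' : M.Within n y z) : M.Within (m + n) x z := by
  induction h with
  | refl => exact h'.mono (by omega)
  | @head k _ _ _ _ ih => exact ((Within.head (ih h')).mono (by omega))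

variable (M)

/-- Pushing a list of letters, and then jumping or halting, as a statement of a stack machine. -/
def exec (x : List (Stack × Letter) × Option L) :
    Turing.TM2.Stmt (fun _ : Stack => Letter) L (Option Letter) :=
  x.1.foldr (fun s q => .push s.1 (fun _ => s.2) q)
    (.load (fun _ => none) (match x.2 with
      | some l => .goto fun _ => l
      | none => .halt))

/-- The statement of an instruction. -/
def stmt (l : L) : Turing.TM2.Stmt (fun _ : Stack => Letter) L (Option Letter) :=
  .pop (M.src l) (fun _ x => x)
    (.branch (fun x => x = some .tick) (exec (M.act l (some .tick)))
      (.branch (fun x => x = some .bar) (exec (M.act l (some .bar)))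
        (.branch (fun x => x = some .finish) (exec (M.act l (some .finish)))
          (exec (M.act l none)))))

/-- Every instruction ends by resetting the internal state to `none`, so between instructions a
configuration is just a label and the stack contents. -/
theorem stepAux_exec (x : List (Stack × Letter) × Option L) (v : Option Letter) (R : Regs) :
    Turing.TM2.stepAux (exec x) v R.get = ⟨x.2, none, (x.1.foldl Regs.push R).get⟩ := by
  obtain ⟨s, l⟩ := x
  induction s generalizing R with
  | nil => cases l <;> rfl
  | cons y s ih =>
    have : exec (y :: s, l) = .push y.1 (fun _ => y.2) (exec (s, l)) := rfl
    rw [this, Turing.TM2.stepAux, Regs.update_get, ih]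
    rfl

theorem stepAux_stmt (l : L) (R : Regs) :
    Turing.TM2.stepAux (M.stmt l) none R.get = ⟨(M.next l R).1, none, (M.next l R).2.get⟩ := by
  rw [stmt, Turing.TM2.stepAux, Regs.update_get, next]
  rcases h : (R.get (M.src l)).head? with _ | _ | _ | _ <;>
    simp [Turing.TM2.stepAux, stepAux_exec]

/-- The bundled stack machine, with input on the stack `inp` and output on the stack `out`. -/
def toFinTM2 [Fintype L] (l₀ : L) : Turing.FinTM2 where
  K := Stack
  k₀ := .inp
  k₁ := .out
  Γ _ := Letter
  Λ := L
  main := l₀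
  σ := Option Letter
  initialState := none
  Γk₀Fin := inferInstanceAs (Fintype Letter)
  m := M.stmt

theorem Within.exists_iterate {n : ℕ} {x y : Option L × Regs} (h : M.Within n x y) :
    ∃ k ≤ n, (flip bind (Turing.TM2.step M.stmt))^[k]
      (some (⟨x.1, none, x.2.get⟩ : Turing.TM2.Cfg (fun _ : Stack => Letter) L (Option Letter))) =
        some ⟨y.1, none, y.2.get⟩ := by
  induction h with
  | refl => exact ⟨0, by omega, rfl⟩
  | @head n l R z _ ih =>
    obtain ⟨k, hk, h⟩ := ih
    refine ⟨k + 1, by omega, ?_⟩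
    rw [Function.iterate_succ_apply, ← h]
    congr 1
    change some _ = _
    rw [M.stepAux_stmt]

/-- The halting configuration `haltList` has all stacks empty except the output stack; this is why a
program must clear its work stacks. -/
theorem outputsInTime [Fintype L] (l₀ : L) {w w' : List Letter} {n : ℕ}
    (h : M.Within n (some l₀, ⟨w, [], [], [], [], [], []⟩) (none, ⟨[], w', [], [], [], [], []⟩)) :
    Nonempty (Turing.TM2OutputsInTime (M.toFinTM2 l₀) w (some w') n) := by
  obtain ⟨k, hk, h⟩ := h.exists_iterate
  refine ⟨⟨⟨k, ?_⟩, hk⟩⟩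
  have h1 : Turing.initList (M.toFinTM2 l₀) w =
      ⟨some l₀, none, Regs.get ⟨w, [], [], [], [], [], []⟩⟩ := by
    unfold Turing.initList
    congr 1
    funext j
    cases j <;> rfl
  have h2 : Turing.haltList (M.toFinTM2 l₀) w' =
      ⟨none, none, Regs.get ⟨[], w', [], [], [], [], []⟩⟩ := by
    unfold Turing.haltList
    congr 1
    funext j
    cases j <;> rfl
  exact (congrArg (flip bind (Turing.TM2.step M.stmt))^[k] (congrArg some h1)).trans
    (h.trans (congrArg some h2.symm))

end PopMachine

end Machine

/-! ### Gadgets that replace pairs -/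

section Gadget

/-- A recipe for replacing the pairs `(a, b)` of a list by gadgets: every gadget has `K` new
vertices, and an edge of the gadget leads from `a` (`Sum.inl false`), from `b` (`Sum.inl true`) or
from a new vertex to a new vertex. -/
structure Gadget (K : ℕ) where
  edges : List ((Bool ⊕ Fin K) × Fin K)

namespace Gadget

variable {K : ℕ}

/-- The number of a vertex of the gadget for the pair `(a, b)` whose new vertices are
`c, c + 1, …`. -/
def number (a b c : ℕ) : Bool ⊕ Fin K → ℕ
  | .inl false => a
  | .inl true => b
  | .inr j => c + j

variable (Γ : Gadget K)

/-- The edges of the gadget for the pair `(a, b)` whose new vertices are `c, c + 1, …`. -/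
def glue (a b c : ℕ) : List (ℕ × ℕ) :=
  Γ.edges.map fun e => (number a b c e.1, c + (e.2 : ℕ))

/-- The edges of the gadgets for a list of pairs. -/
def expand : ℕ → List (ℕ × ℕ) → List (ℕ × ℕ)
  | _, [] => []
  -- The output is a stack, so what is written last stands first: later gadgets precede earlier
  -- ones, and each gadget is reversed.
  | c, e :: l => expand (c + K) l ++ (Γ.glue e.1 e.2 c).reverse

end Gadget

end Gadget

/-! ### The gadget program and its running time -/

section Program

/-- The numbers that the machine has at its disposal: the entries `a`, `b` of the current pair, and
the number `c` of vertices so far. -/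
inductive Source : Type
  | a | b | c
  deriving DecidableEq

instance : Fintype Source where
  elems := {.a, .b, .c}
  complete x := by cases x <;> simp

def Source.stack : Source → Stack
  | .a => .a
  | .b => .b
  | .c => .c

def Source.val (a b c : ℕ) : Source → ℕ
  | .a => a
  | .b => b
  | .c => c

/-- The numbers that are to be written for an edge of a gadget, as a source and an addend. -/
def Gadget.edgeOps {K : ℕ} (e : (Bool ⊕ Fin K) × Fin K) : List (Source × ℕ) :=
  -- The second end is written first, because the output grows towards the front.
  [(.c, (e.2 : ℕ)), match e.1 with
    | .inl false => (.a, 0)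
    | .inl true => (.b, 0)
    | .inr j => (.c, (j : ℕ))]

/-- The numbers that are to be written for a gadget. -/
def Gadget.ops {K : ℕ} (Γ : Gadget K) : List (Source × ℕ) := Γ.edges.flatMap edgeOps

/-- The instructions of the gadget machine. The flag `ph` says that the first word is still on the
stack `save`, and `last` says that the current pair is the last one of the word. -/
inductive Label (m : ℕ) : Type
  | skip
  | size (ph : Bool)
  | fst (ph : Bool)
  | snd (ph : Bool)
  | copy (s : Source) (i : Fin m) (last ph : Bool)
  | back (s : Source) (i : Fin m) (last ph : Bool)
  | clearA (last ph : Bool)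
  | clearB (last ph : Bool)
  | dump (ph : Bool)
  | restore
  deriving Fintype

/-- The instruction that starts writing the `i`-th number. -/
def Label.emit (ops : List (Source × ℕ)) (i : ℕ) (last ph : Bool) : Label ops.length :=
  if h : i < ops.length then .copy ops[i].1 ⟨i, h⟩ last ph else .clearA last ph

/-- The program that replaces, in two words, every pair by a gadget. -/
def program (ops : List (Source × ℕ)) (K : ℕ) : PopMachine (Label ops.length) where
  src
    | .skip => .inp
    | .size _ => .inp
    | .fst _ => .inp
    | .snd _ => .inp
    | .copy s _ _ _ => s.stack
    | .back _ _ _ _ => .tmp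
    | .clearA _ _ => .a
    | .clearB _ _ => .b
    | .dump _ => .c
    | .restore => .save
  act
    -- The second word has to be treated first, again because the output is written from its end;
    -- the letter pushed here is the end mark of the whole output.
    | .skip, some .finish => ([(.out, .finish)], some (.size true))
    | .skip, some x => ([(.save, x)], some .skip)
    | .skip, none => ([], none)
    | .size ph, some .tick => ([(.c, .tick)], some (.size ph))
    | .size ph, some .bar => ([], some (.fst ph))
    | .size ph, _ => ([], some (.dump ph))
    | .fst ph, some .tick => ([(.a, .tick)], some (.fst ph))
    | .fst ph, _ => ([], some (.snd ph))
    | .snd ph, some .tick => ([(.b, .tick)], some (.snd ph))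
    | .snd ph, some .bar => ([], some (.emit ops 0 false ph))
    | .snd ph, _ => ([], some (.emit ops 0 true ph))
    | .copy s i last ph, some _ => ([(.out, .tick), (.tmp, .tick)], some (.copy s i last ph))
    -- Copying has emptied the register into `tmp`; the addend is written, and `back` refills the
    -- register.
    | .copy s i last ph, none =>
      (List.replicate ops[i].2 (.out, .tick), some (.back s i last ph))
    | .back s i last ph, some _ => ([(s.stack, .tick)], some (.back s i last ph))
    | .back s i last ph, none => ([(.out, .bar)], some (.emit ops (i + 1) last ph))
    | .clearA last ph, some _ => ([], some (.clearA last ph))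
    | .clearA last ph, none => ([], some (.clearB last ph))
    | .clearB last ph, some _ => ([], some (.clearB last ph))
    | .clearB last ph, none =>
      (List.replicate K (.c, .tick), some (if last then .dump ph else .fst ph))
    | .dump ph, some _ => ([(.out, .tick)], some (.dump ph))
    -- The second word has been used up. The first one, saved in reverse, returns to the input stack
    -- on top of a new end mark.
    | .dump true, none => ([(.inp, .finish)], some .restore)
    | .dump false, none => ([], none)
    | .restore, some x => ([(.inp, x)], some .restore)
    | .restore, none => ([(.out, .finish)], some (.size false))

/-- A number in unary. -/
abbrev ticks (n : ℕ) : List Letter := List.replicate n .tick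

theorem ticks_succ_append (n : ℕ) (w : List Letter) :
    ticks (n + 1) ++ w = .tick :: (ticks n ++ w) := rfl

theorem ticks_append_cons (n : ℕ) (w : List Letter) :
    ticks n ++ .tick :: w = .tick :: (ticks n ++ w) := by
  induction n with
  | zero => rfl
  | succ n ih => simp only [ticks_succ_append, ih]

theorem foldl_push_c (n : ℕ) (R : Regs) :
    (List.replicate n (Stack.c, Letter.tick)).foldl Regs.push R =
      { R with c := ticks n ++ R.c } := by
  induction n generalizing R with
  | zero => rfl
  | succ n ih =>
    rw [List.replicate_succ, List.foldl_cons, ih]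
    simp [Regs.push, Regs.set, Regs.get, ticks_append_cons, ticks_succ_append]

theorem foldl_push_out (n : ℕ) (R : Regs) :
    (List.replicate n (Stack.out, Letter.tick)).foldl Regs.push R =
      { R with out := ticks n ++ R.out } := by
  induction n generalizing R with
  | zero => rfl
  | succ n ih =>
    rw [List.replicate_succ, List.foldl_cons, ih]
    simp [Regs.push, Regs.set, Regs.get, ticks_append_cons, ticks_succ_append]

namespace program

open PopMachine

variable {ops : List (Source × ℕ)} {K : ℕ} {I O S A B C T w : List Letter} {ph last : Bool}

local notation "M" => program ops K

/-- Reading the number of vertices. -/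
theorem size_ticks (n : ℕ) : Within (M) n (some (.size ph), ⟨ticks n ++ w, O, S, A, B, C, T⟩)
    (some (.size ph), ⟨w, O, S, A, B, ticks n ++ C, T⟩) := by
  induction n generalizing C with
  | zero => exact .refl _ _
  | succ n ih =>
    refine .head ?_
    have := ih (C := .tick :: C)
    rw [ticks_append_cons] at this
    exact this

theorem fst_ticks (n : ℕ) : Within (M) (n + 1)
    (some (.fst ph), ⟨ticks n ++ .bar :: w, O, S, A, B, C, T⟩)
    (some (.snd ph), ⟨w, O, S, ticks n ++ A, B, C, T⟩) := by
  induction n generalizing A with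
  | zero => exact .head (.refl _ _)
  | succ n ih =>
    refine .head ?_
    have := ih (A := .tick :: A)
    rw [ticks_append_cons] at this
    exact this

theorem snd_ticks (n : ℕ) (last : Bool) : Within (M) (n + 1)
    (some (.snd ph), ⟨ticks n ++ (if last then .finish else .bar) :: w, O, S, A, B, C, T⟩)
    (some (.emit ops 0 last ph), ⟨w, O, S, A, ticks n ++ B, C, T⟩) := by
  induction n generalizing B with
  | zero => cases last <;> exact .head (.refl _ _)
  | succ n ih =>
    refine .head ?_
    have := ih (B := .tick :: B)
    rw [ticks_append_cons] at this
    exact this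

theorem clearA_ticks (n : ℕ) : Within (M) (n + 1)
    (some (.clearA last ph), ⟨I, O, S, ticks n, B, C, T⟩)
    (some (.clearB last ph), ⟨I, O, S, [], B, C, T⟩) := by
  induction n with
  | zero => exact .head (.refl _ _)
  | succ n ih => exact .head ih

theorem clearB_ticks (n : ℕ) : Within (M) (n + 1)
    (some (.clearB last ph), ⟨I, O, S, A, ticks n, C, T⟩)
    (some (if last then .dump ph else .fst ph), ⟨I, O, S, A, [], ticks K ++ C, T⟩) := by
  induction n with
  | zero =>
    refine .head ?_
    have : (M).next (.clearB last ph) ⟨I, O, S, A, ticks 0, C, T⟩ =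
      (some (if last then .dump ph else .fst ph), ⟨I, O, S, A, [], ticks K ++ C, T⟩) :=
      Prod.ext rfl (foldl_push_c _ _)
    rw [this]
    exact .refl _ _
  | succ n ih => exact .head ih

theorem dump_ticks (n : ℕ) : Within (M) n
    (some (.dump ph), ⟨I, O, S, A, B, ticks n, T⟩)
    (some (.dump ph), ⟨I, ticks n ++ O, S, A, B, [], T⟩) := by
  induction n generalizing O with
  | zero => exact .refl _ _
  | succ n ih =>
    refine .head ?_
    have := ih (O := .tick :: O)
    rw [ticks_append_cons] at this
    exact this

theorem dump_true (n : ℕ) : Within (M) (n + 1)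
    (some (.dump true), ⟨I, O, S, A, B, ticks n, T⟩)
    (some .restore, ⟨.finish :: I, ticks n ++ O, S, A, B, [], T⟩) :=
  (dump_ticks n).trans (.head (.refl 0 _))

theorem dump_false (n : ℕ) : Within (M) (n + 1)
    (some (.dump false), ⟨I, O, S, A, B, ticks n, T⟩)
    (none, ⟨I, ticks n ++ O, S, A, B, [], T⟩) :=
  (dump_ticks n).trans (.head (.refl 0 _))

theorem skip_word (u : List Letter) (hu : Letter.finish ∉ u) : Within (M) (u.length + 1)
    (some .skip, ⟨u ++ .finish :: w, O, S, A, B, C, T⟩)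
    (some (.size true), ⟨w, .finish :: O, u.reverse ++ S, A, B, C, T⟩) := by
  induction u generalizing S with
  | nil => exact .head (.refl _ _)
  | cons x u ih =>
    rw [List.mem_cons, not_or] at hu
    have := ih hu.2 (S := x :: S)
    rw [List.reverse_cons, List.append_assoc]
    refine .head ?_
    cases x with
    | finish => exact (hu.1 rfl).elim
    | tick => exact this
    | bar => exact this

theorem restore_word (u : List Letter) : Within (M) (u.length + 1)
    (some .restore, ⟨I, O, u, A, B, C, T⟩)
    (some (.size false), ⟨u.reverse ++ I, .finish :: O, [], A, B, C, T⟩) := by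
  induction u generalizing I with
  | nil => exact .head (.refl _ _)
  | cons x u ih =>
    have := ih (I := x :: I)
    rw [List.reverse_cons, List.append_assoc]
    exact .head this

/-- The register of the source, the output and the stack `tmp` are overwritten. -/
def _root_.KDim.Regs.hold (R : Regs) (s : Source) (X Y Z : List Letter) : Regs :=
  { R.set s.stack X with out := Y, tmp := Z }

theorem copy_loop (R : Regs) (s : Source) (i : Fin ops.length) (n : ℕ) : Within (M) (n + 1)
    (some (.copy s i last ph), R.hold s (ticks n) O T)
    (some (.back s i last ph), R.hold s [] (ticks (n + ops[i].2) ++ O) (ticks n ++ T)) := by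
  induction n generalizing O T with
  | zero =>
    refine .head ?_
    have : (M).next (.copy s i last ph) (R.hold s (ticks 0) O T) =
        (some (.back s i last ph), R.hold s [] (ticks (0 + ops[i].2) ++ O) (ticks 0 ++ T)) := by
      rw [zero_add]
      cases s <;> exact Prod.ext rfl (foldl_push_out _ _)
    rw [this]
    exact .refl _ _
  | succ n ih =>
    refine .head ?_
    have : (M).next (.copy s i last ph) (R.hold s (ticks (n + 1)) O T) =
        (some (.copy s i last ph), R.hold s (ticks n) (.tick :: O) (.tick :: T)) := by
      cases s <;> rfl
    rw [this, Nat.add_right_comm, ticks_succ_append, ← ticks_append_cons, ticks_succ_append,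
      ← ticks_append_cons]
    exact ih

theorem back_loop (R : Regs) (s : Source) (i : Fin ops.length) (n : ℕ) : Within (M) (n + 1)
    (some (.back s i last ph), R.hold s T O (ticks n))
    (some (.emit ops (i + 1) last ph), R.hold s (ticks n ++ T) (.bar :: O) []) := by
  induction n generalizing T with
  | zero =>
    refine .head ?_
    have : (M).next (.back s i last ph) (R.hold s T O (ticks 0)) =
        (some (.emit ops (i + 1) last ph), R.hold s T (.bar :: O) []) := by
      cases s <;> rfl
    rw [this]
    exact .refl _ _
  | succ n ih =>
    refine .head ?_
    have : (M).next (.back s i last ph) (R.hold s T O (ticks (n + 1))) =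
        (some (.back s i last ph), R.hold s (.tick :: T) O (ticks n)) := by
      cases s <;> rfl
    rw [this, ticks_succ_append, ← ticks_append_cons]
    exact ih

/-- Writing a number. -/
theorem emit_one {i : ℕ} (hi : i < ops.length) {a b c N : ℕ} (ha : a ≤ N) (hb : b ≤ N)
    (hc : c ≤ N) : Within (M) (2 * N + 2)
    (some (.emit ops i last ph), ⟨I, O, S, ticks a, ticks b, ticks c, []⟩)
    (some (.emit ops (i + 1) last ph),
      ⟨I, .bar :: (ticks (ops[i].1.val a b c + ops[i].2) ++ O), S,
        ticks a, ticks b, ticks c, []⟩) := by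
  -- Writing the registers as `Regs.hold` lets one statement of the two loops serve all three
  -- sources.
  have key : ∀ (s : Source) (O : List Letter),
      (⟨I, O, S, ticks a, ticks b, ticks c, []⟩ : Regs) =
        Regs.hold ⟨I, [], S, ticks a, ticks b, ticks c, []⟩ s (ticks (s.val a b c)) O [] := by
    intro s O
    cases s <;> rfl
  have hv : ops[i].1.val a b c ≤ N := by
    cases ops[i].1 <;> assumption
  have h1 := (copy_loop (K := K) (last := last) (ph := ph) (O := O) (T := [])
    ⟨I, [], S, ticks a, ticks b, ticks c, []⟩ ops[i].1 ⟨i, hi⟩ (ops[i].1.val a b c))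
  have h2 := (back_loop (K := K) (last := last) (ph := ph) (T := [])
    (O := ticks (ops[i].1.val a b c + ops[i].2) ++ O)
    ⟨I, [], S, ticks a, ticks b, ticks c, []⟩ ops[i].1 ⟨i, hi⟩ (ops[i].1.val a b c))
  rw [List.append_nil] at h1 h2
  have h3 := (h1.trans h2).mono (n := 2 * N + 2) (by omega)
  rw [← key, ← key] at h3
  have h4 : Label.emit ops i last ph = .copy ops[i].1 ⟨i, hi⟩ last ph := by
    rw [Label.emit, dif_pos hi]
  rw [h4]
  exact h3

/-- The word for the numbers written. -/
def written (a b c : ℕ) (l : List (Source × ℕ)) (w : List Letter) : List Letter :=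
  l.foldl (fun O o => .bar :: (ticks (o.1.val a b c + o.2) ++ O)) w

/-- Writing all the numbers for a gadget. -/
theorem emit_all {a b c N : ℕ} (ha : a ≤ N) (hb : b ≤ N) (hc : c ≤ N) :
    Within (M) (ops.length * (2 * N + 2))
    (some (.emit ops 0 last ph), ⟨I, O, S, ticks a, ticks b, ticks c, []⟩)
    (some (.clearA last ph), ⟨I, written a b c ops O, S, ticks a, ticks b, ticks c, []⟩) := by
  have key : ∀ i ≤ ops.length, Within (M) (i * (2 * N + 2))
      (some (.emit ops 0 last ph), ⟨I, O, S, ticks a, ticks b, ticks c, []⟩)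
      (some (.emit ops i last ph),
        ⟨I, written a b c (ops.take i) O, S, ticks a, ticks b, ticks c, []⟩) := by
    intro i
    induction i with
    | zero =>
      intro _
      rw [List.take_zero, zero_mul]
      exact .refl _ _
    | succ i ih =>
      intro hi
      rw [add_one_mul]
      refine (ih (by omega)).trans ?_
      have h : written a b c (ops.take (i + 1)) O = .bar ::
          (ticks (ops[i].1.val a b c + ops[i].2) ++ written a b c (ops.take i) O) := by
        rw [written, List.take_add_one, List.getElem?_eq_getElem (by omega), List.foldl_append]
        rfl
      rw [h]
      exact emit_one _ ha hb hc
  have := key ops.length le_rfl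
  rwa [List.take_length, show Label.emit ops ops.length last ph = .clearA last ph by
    rw [Label.emit, dif_neg (lt_irrefl _)]] at this

/-- The treatment of one pair. -/
theorem pair {a b c N : ℕ} (last : Bool) (ha : a ≤ N) (hb : b ≤ N) (hc : c ≤ N) :
    Within (M) ((ops.length + 2) * (2 * N + 2))
    (some (.fst ph), ⟨ticks a ++ .bar :: (ticks b ++ (if last then .finish else .bar) :: I),
      O, S, [], [], ticks c, []⟩)
    (some (if last then .dump ph else .fst ph),
      ⟨I, written a b c ops O, S, [], [], ticks (c + K), []⟩) := by
  have h1 := fst_ticks (ops := ops) (K := K) (ph := ph) (O := O) (S := S) (A := []) (B := [])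
    (C := ticks c) (T := []) (w := ticks b ++ (if last then .finish else .bar) :: I) a
  have h2 := snd_ticks (ops := ops) (K := K) (ph := ph) (O := O) (S := S) (A := ticks a)
    (B := []) (C := ticks c) (T := []) (w := I) b last
  have h4 := clearA_ticks (ops := ops) (K := K) (last := last) (ph := ph) (I := I)
    (O := written a b c ops O) (S := S) (B := ticks b) (C := ticks c) (T := []) a
  have h5 := clearB_ticks (ops := ops) (K := K) (last := last) (ph := ph) (I := I)
    (O := written a b c ops O) (S := S) (A := []) (C := ticks c) (T := []) b
  rw [List.append_nil] at h1 h2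
  -- Reading `a` and `b` and clearing them again costs at most `4 * (N + 1)` steps, which accounts
  -- for the `+ 2` beside `ops.length`.
  have := ((((h1.trans h2).trans (emit_all ha hb hc)).trans h4).trans h5).mono
    (n := (ops.length + 2) * (2 * N + 2)) (by rw [add_mul]; omega)
  rwa [show ticks K ++ ticks c = ticks (c + K) by rw [add_comm]; simp [ticks]] at this

end program

end Program

/-! ### Correctness on whole words, and polynomial time -/

section Program

/-- The word for a list of pairs. -/
def pairsWord (l : List (ℕ × ℕ)) : List Letter :=
  l.flatMap fun e => .bar :: ticks e.1 ++ (.bar :: ticks e.2)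

theorem pairsWord_cons (e : ℕ × ℕ) (l : List (ℕ × ℕ)) :
    pairsWord (e :: l) = .bar :: (ticks e.1 ++ .bar :: (ticks e.2 ++ pairsWord l)) := by
  simp [pairsWord]

theorem pairsWord_append (l l' : List (ℕ × ℕ)) :
    pairsWord (l ++ l') = pairsWord l ++ pairsWord l' := List.flatMap_append

theorem finish_notMem_pairsWord (l : List (ℕ × ℕ)) : Letter.finish ∉ pairsWord l := by
  simp [pairsWord]

theorem encodeData_eq (n : ℕ) (l : List (ℕ × ℕ)) (w : List Letter) :
    encodeData n l ++ w = ticks n ++ (pairsWord l ++ .finish :: w) := by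
  simp [encodeData, pairsWord, ticks]

theorem length_le_length_pairsWord (l : List (ℕ × ℕ)) : l.length ≤ (pairsWord l).length := by
  induction l with
  | nil => simp
  | cons e l ih => rw [pairsWord_cons]; simp; omega

theorem le_length_pairsWord {l : List (ℕ × ℕ)} {e : ℕ × ℕ} (h : e ∈ l) :
    e.1 ≤ (pairsWord l).length ∧ e.2 ≤ (pairsWord l).length := by
  induction l with
  | nil => simp at h
  | cons f l ih =>
    rw [pairsWord_cons]
    rcases List.mem_cons.1 h with rfl | h
    · simp; omega
    · have := ih h
      simp; omega

theorem length_encodeData (n : ℕ) (l : List (ℕ × ℕ)) :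
    (encodeData n l).length = n + (pairsWord l).length + 1 := by
  have := congrArg List.length (encodeData_eq n l [])
  simp only [List.append_nil, List.length_append, List.length_replicate, List.length_cons,
    List.length_nil] at this
  omega

namespace program

open PopMachine

variable {K : ℕ} (Γ : Gadget K) {I O S : List Letter} {ph : Bool}

local notation "M" => program Γ.ops K

/-- Each newly written edge lands in front of the earlier ones, which is the order of the reversed
list. -/
theorem written_ops (a b c : ℕ) (w : List Letter) :
    written a b c Γ.ops w = pairsWord (Γ.glue a b c).reverse ++ w := by
  rw [Gadget.ops, Gadget.glue]
  induction Γ.edges generalizing w with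
  | nil => rfl
  | cons e l ih =>
    have : written a b c ((e :: l).flatMap Gadget.edgeOps) w =
        written a b c (l.flatMap Gadget.edgeOps) (written a b c (Gadget.edgeOps e) w) := by
      rw [written, List.flatMap_cons, List.foldl_append]
      rfl
    rw [this, ih, List.map_cons, List.reverse_cons, pairsWord_append, List.append_assoc]
    congr 1
    rw [pairsWord_cons]
    rcases e with ⟨(_ | _) | j, k⟩ <;>
      simp [written, Gadget.edgeOps, Gadget.number, Source.val, pairsWord]

/-- The treatment of a nonempty list of pairs. -/
theorem pairs {N : ℕ} (l : List (ℕ × ℕ)) (e : ℕ × ℕ) (c : ℕ)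
    (hl : ∀ f ∈ e :: l, f.1 ≤ N ∧ f.2 ≤ N) (hc : c + K * l.length ≤ N) :
    Within (M) ((e :: l).length * ((Γ.ops.length + 2) * (2 * N + 2)))
      (some (.fst ph), ⟨ticks e.1 ++ .bar :: (ticks e.2 ++ (pairsWord l ++ .finish :: I)),
        O, S, [], [], ticks c, []⟩)
      (some (.dump ph), ⟨I, pairsWord (Γ.expand c (e :: l)) ++ O, S, [], [],
        ticks (c + K * (e :: l).length), []⟩) := by
  induction l generalizing e c O with
  | nil =>
    have he := hl e (by simp)
    have h := pair (ops := Γ.ops) (K := K) (I := I) (O := O) (S := S) (ph := ph) true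
      he.1 he.2 (c := c) (by omega)
    rw [written_ops] at h
    simpa [Gadget.expand, pairsWord] using h
  | cons f l ih =>
    have he := hl e (by simp)
    have h := pair (ops := Γ.ops) (K := K) (O := O) (S := S) (ph := ph)
      (I := ticks f.1 ++ .bar :: (ticks f.2 ++ (pairsWord l ++ .finish :: I))) false
      he.1 he.2 (c := c) (by omega)
    rw [List.length_cons, mul_add_one] at hc
    have h' := h.trans (ih f (c + K) (fun g hg => hl g (by simp_all)) (by omega))
    rw [written_ops, ← List.append_assoc (pairsWord (Γ.expand _ _)), ← pairsWord_append] at h'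
    refine Eq.mp ?_ (h'.mono (n := (e :: f :: l).length *
      ((Γ.ops.length + 2) * (2 * N + 2))) ?_)
    · rw [pairsWord_cons]
      simp only [List.length_cons, List.cons_append, List.append_assoc, Gadget.expand,
        Bool.false_eq_true, if_false]
      rw [show c + K + K * (l.length + 1) = c + K * (l.length + 1 + 1) by ring]
    · simp only [List.length_cons]
      rw [add_one_mul (l.length + 1), add_comm]

/-- The treatment of a word. -/
theorem word {N n : ℕ} {l : List (ℕ × ℕ)} (hl : ∀ f ∈ l, f.1 ≤ N ∧ f.2 ≤ N)
    (hn : n + K * l.length ≤ N) :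
    Within (M) (n + 1 + l.length * ((Γ.ops.length + 2) * (2 * N + 2)))
      (some (.size ph), ⟨encodeData n l ++ I, .finish :: O, S, [], [], [], []⟩)
      (some (.dump ph), ⟨I, pairsWord (Γ.expand n l) ++ .finish :: O, S, [], [],
        ticks (n + K * l.length), []⟩) := by
  have h := size_ticks (ops := Γ.ops) (K := K) (w := pairsWord l ++ .finish :: I)
    (ph := ph) (O := .finish :: O) (S := S) (A := []) (B := []) (C := []) (T := []) n
  rw [List.append_nil, ← encodeData_eq] at h
  rw [add_assoc]
  refine h.trans ?_
  rw [add_comm]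
  cases l with
  | nil => exact (Within.head (.refl 0 _)).mono (by simp)
  | cons e l =>
    refine .head ?_
    have hn' : n + K * l.length ≤ N := by
      rw [List.length_cons, mul_add_one] at hn
      omega
    have := pairs Γ (I := I) (O := .finish :: O) (S := S) (ph := ph) l e n hl hn'
    have h : pairsWord (e :: l) ++ .finish :: I = .bar ::
      (ticks e.1 ++ .bar :: (ticks e.2 ++ (pairsWord l ++ .finish :: I))) := by
      rw [pairsWord_cons]; simp
    rw [h]
    exact this

/-- A bound for the number of steps that the machine makes on inputs of length `L`. -/
def time (L : ℕ) : ℕ :=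
  2 * (L + 1) + 2 * ((L + 1) + L * ((Γ.ops.length + 2) * (2 * ((K + 1) * L) + 2)) +
    ((K + 1) * L + 1))

/-- The phases are: set the first word aside, expand the second and dump its vertex counter, put the
first word back, expand it and dump its counter. The counter is final only when all pairs are
treated, which fits, since the number of vertices stands at the front of a word. All numbers met are
at most `N = (K + 1) * L`, since a counter is at most `n + K * l.length`. -/
theorem words (n₁ n₂ : ℕ) (l₁ l₂ : List (ℕ × ℕ)) :
    Within (M) (time Γ (encodeData n₁ l₁ ++ encodeData n₂ l₂).length)
      (some .skip, ⟨encodeData n₁ l₁ ++ encodeData n₂ l₂, [], [], [], [], [], []⟩)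
      (none, ⟨[], encodeData (n₁ + K * l₁.length) (Γ.expand n₁ l₁) ++
        encodeData (n₂ + K * l₂.length) (Γ.expand n₂ l₂), [], [], [], [], []⟩) := by
  set L := (encodeData n₁ l₁ ++ encodeData n₂ l₂).length with hL
  set N := (K + 1) * L with hN
  rw [List.length_append, length_encodeData, length_encodeData] at hL
  have hLN : L ≤ N := Nat.le_mul_of_pos_left _ (Nat.succ_pos _)
  have hsize : ∀ n (l : List (ℕ × ℕ)), n + (pairsWord l).length ≤ L →
      n + K * l.length ≤ N := by
    intro n l h
    have h1 := length_le_length_pairsWord l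
    have h2 : K * l.length ≤ K * L := Nat.mul_le_mul_left _ (by omega)
    rw [hN, add_one_mul]
    have : l.length ≤ L := by omega
    omega
  have hmem : ∀ n (l : List (ℕ × ℕ)), n + (pairsWord l).length ≤ L →
      ∀ f ∈ l, f.1 ≤ N ∧ f.2 ≤ N := by
    intro n l h f hf
    have := le_length_pairsWord hf
    omega
  have hword : ∀ n (l : List (ℕ × ℕ)), n + (pairsWord l).length ≤ L →
      n + 1 + l.length * ((Γ.ops.length + 2) * (2 * N + 2)) ≤
        L + 1 + L * ((Γ.ops.length + 2) * (2 * N + 2)) := by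
    intro n l h
    have h1 := length_le_length_pairsWord l
    have h2 := Nat.mul_le_mul_right ((Γ.ops.length + 2) * (2 * N + 2))
      (show l.length ≤ L by omega)
    omega
  have b₁ : n₁ + (pairsWord l₁).length ≤ L := by omega
  have b₂ : n₂ + (pairsWord l₂).length ≤ L := by omega
  have s1 := skip_word (ops := Γ.ops) (K := K) (w := encodeData n₂ l₂) (O := []) (S := [])
    (A := []) (B := []) (C := []) (T := []) (ticks n₁ ++ pairsWord l₁)
    (by simp [finish_notMem_pairsWord])
  rw [List.append_assoc, ← encodeData_eq] at s1
  have s2 := word Γ (ph := true) (I := []) (O := []) (S := (ticks n₁ ++ pairsWord l₁).reverse)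
    (hmem _ _ b₂) (hsize _ _ b₂)
  have s3 := dump_true (ops := Γ.ops) (K := K) (I := [])
    (O := pairsWord (Γ.expand n₂ l₂) ++ [.finish]) (S := (ticks n₁ ++ pairsWord l₁).reverse)
    (A := []) (B := []) (T := []) (n₂ + K * l₂.length)
  rw [← encodeData_eq] at s3
  have s4 := restore_word (ops := Γ.ops) (K := K) (I := [.finish])
    (O := encodeData (n₂ + K * l₂.length) (Γ.expand n₂ l₂) ++ [])
    (A := []) (B := []) (C := []) (T := []) (ticks n₁ ++ pairsWord l₁).reverse
  rw [List.reverse_reverse, List.append_assoc, ← encodeData_eq,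
    List.length_reverse] at s4
  rw [List.append_nil (encodeData _ (Γ.expand n₂ l₂))] at s3 s4
  have s5 := word Γ (ph := false) (I := []) (S := [])
    (O := encodeData (n₂ + K * l₂.length) (Γ.expand n₂ l₂)) (hmem _ _ b₁) (hsize _ _ b₁)
  have s6 := dump_false (ops := Γ.ops) (K := K) (I := []) (O := pairsWord (Γ.expand n₁ l₁) ++
    .finish :: encodeData (n₂ + K * l₂.length) (Γ.expand n₂ l₂)) (S := [])
    (A := []) (B := []) (T := []) (n₁ + K * l₁.length)
  rw [← encodeData_eq] at s6
  rw [List.append_nil] at s1 s2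
  refine (((((s1.trans s2).trans s3).trans s4).trans s5).trans s6).mono ?_
  have := hword _ _ b₁
  have := hword _ _ b₂
  have := hsize _ _ b₁
  have := hsize _ _ b₂
  rw [time, ← hN, List.length_append, List.length_replicate]
  omega

open Polynomial in
/-- Replacing the pairs of two lists by gadgets is possible in polynomial time. -/
theorem computable {α β : Type} {ea : α → List Letter} {eb : β → List Letter} {f : α → β}
    (h : ∀ x, ∃ n₁ n₂ l₁ l₂, ea x = encodeData n₁ l₁ ++ encodeData n₂ l₂ ∧
      eb (f x) = encodeData (n₁ + K * l₁.length) (Γ.expand n₁ l₁) ++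
        encodeData (n₂ + K * l₂.length) (Γ.expand n₂ l₂)) :
    Nonempty (Turing.TM2ComputableInPolyTime ea eb f) := by
  have h' : ∀ x, Nonempty (Turing.TM2OutputsInTime ((M).toFinTM2 .skip) (ea x)
      (some (eb (f x))) (time Γ (ea x).length)) := by
    intro x
    obtain ⟨n₁, n₂, l₁, l₂, h₁, h₂⟩ := h x
    rw [h₁, h₂]
    exact (M).outputsInTime .skip (words Γ n₁ n₂ l₁ l₂)
  refine ⟨{
    tm := (M).toFinTM2 .skip
    inputAlphabet := Equiv.refl Letter
    outputAlphabet := Equiv.refl Letter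
    time := 2 * (X + 1) + 2 * ((X + 1) + X * ((C Γ.ops.length + 2) *
      (2 * ((C K + 1) * X) + 2)) + ((C K + 1) * X + 1))
    outputsFun := fun x => ?_ }⟩
  have e : ∀ w : List Letter, w.map (Equiv.refl Letter).invFun = w := fun w => List.map_id w
  have ht : time Γ (ea x).length = eval (ea x).length (2 * (X + 1) + 2 * ((X + 1) + X *
      ((C Γ.ops.length + 2) * (2 * ((C K + 1) * X) + 2)) + ((C K + 1) * X + 1))) := by
    simp [time]
  rw [← ht]
  exact (congrArg₂ (fun u v => Turing.TM2OutputsInTime ((M).toFinTM2 .skip) u (some v)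
    (time Γ (ea x).length)) (e (ea x)) (e (eb (f x)))).mpr (h' x).some

end program

end Program

/-! ### Expanded lists as codes of graphs and posets -/

section Expansion

namespace Gadget

/-- The edges of a gadget are proper, and none of them is repeated or reversed. -/
structure Valid {K : ℕ} (Γ : Gadget K) : Prop where
  nodup : Γ.edges.Nodup
  ne : ∀ j k, (Sum.inr j, k) ∈ Γ.edges → j ≠ k
  asymm : ∀ j k, (Sum.inr j, k) ∈ Γ.edges → (Sum.inr k, j) ∉ Γ.edges

/-- No edge of the gadget ends where another one begins. -/
def Bipartite {K : ℕ} (Γ : Gadget K) : Prop :=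
  ∀ j k s, (Sum.inr j, k) ∈ Γ.edges → (s, j) ∉ Γ.edges

variable {K : ℕ} (Γ : Gadget K) {n : ℕ} {l : List (ℕ × ℕ)}

/-- The numbering of the original and the new vertices. -/
def numbering (K n m : ℕ) : Fin n ⊕ (Fin m × Fin K) ≃ Fin (n + K * m) :=
  ((Equiv.refl _).sumCongr finProdFinEquiv).trans
    (finSumFinEquiv.trans (finCongr (by rw [mul_comm])))

theorem numbering_inl {m : ℕ} (a : Fin n) : (numbering K n m (.inl a) : ℕ) = a := by
  simp [numbering]

theorem numbering_inr {m : ℕ} (i : Fin m) (j : Fin K) :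
    (numbering K n m (.inr (i, j)) : ℕ) = n + K * i + j := by
  simp [numbering]
  ring

/-- The vertices of the `i`-th gadget. -/
def loc (hl : ∀ e ∈ l, e.1 < n ∧ e.2 < n) (i : Fin l.length) :
    Bool ⊕ Fin K → Fin n ⊕ (Fin l.length × Fin K)
  | .inl false => .inl ⟨l[i].1, (hl _ (List.getElem_mem _)).1⟩
  | .inl true => .inl ⟨l[i].2, (hl _ (List.getElem_mem _)).2⟩
  | .inr j => .inr (i, j)

/-- A new vertex belongs to a single gadget, so conditions on edges that meet in a new vertex can be
checked in one copy of the gadget. -/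
theorem loc_eq_inr {hl : ∀ e ∈ l, e.1 < n ∧ e.2 < n} {i i' : Fin l.length}
    {s : Bool ⊕ Fin K} {j : Fin K} (h : loc hl i s = .inr (i', j)) :
    i = i' ∧ s = .inr j := by
  rcases s with (_ | _) | k <;> simp [loc] at h
  simp [h]

theorem mem_expand_iff (c : ℕ) (l : List (ℕ × ℕ)) (x : ℕ × ℕ) :
    x ∈ Γ.expand c l ↔
      ∃ i : Fin l.length, x ∈ Γ.glue l[i].1 l[i].2 (c + K * i) := by
  induction l generalizing c with
  | nil => simp [expand]
  | cons e l ih =>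
    rw [expand, List.mem_append, ih, List.mem_reverse]
    constructor
    · rintro (⟨i, h⟩ | h)
      · refine ⟨i.succ, ?_⟩
        have : c + K * (i.succ : ℕ) = c + K + K * i := by
          rw [Fin.val_succ]; ring
        rw [this]
        exact h
      · exact ⟨0, h⟩
    · rintro ⟨i, h⟩
      cases i using Fin.cases with
      | zero => exact .inr h
      | succ i =>
        refine .inl ⟨i, ?_⟩
        have : c + K * (i.succ : ℕ) = c + K + K * i := by
          rw [Fin.val_succ]; ring
        rw [this] at h
        exact h

theorem mem_expand (hl : ∀ e ∈ l, e.1 < n ∧ e.2 < n) {x : ℕ × ℕ} :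
    x ∈ Γ.expand n l ↔ ∃ i : Fin l.length, ∃ e ∈ Γ.edges,
      ((numbering K n l.length (loc hl i e.1) : ℕ),
        (numbering K n l.length (.inr (i, e.2)) : ℕ)) = x := by
  rw [mem_expand_iff]
  refine exists_congr fun i => ?_
  rw [glue, List.mem_map]
  refine exists_congr fun e => and_congr_right fun _ => ?_
  rw [numbering_inr]
  have : number l[i].1 l[i].2 (n + K * i) e.1 =
      (numbering K n l.length (loc hl i e.1) : ℕ) := by
    rcases e.1 with (_ | _) | j
    · rw [loc, numbering_inl]; rfl
    · rw [loc, numbering_inl]; rfl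
    · rw [loc, numbering_inr]; rfl
  rw [this]

theorem numbering_mem_expand (hl : ∀ e ∈ l, e.1 < n ∧ e.2 < n)
    (x y : Fin n ⊕ (Fin l.length × Fin K)) :
    ((numbering K n l.length x : ℕ), (numbering K n l.length y : ℕ)) ∈ Γ.expand n l ↔
      ∃ i : Fin l.length, ∃ e ∈ Γ.edges, loc hl i e.1 = x ∧ .inr (i, e.2) = y := by
  rw [mem_expand Γ hl]
  simp [Fin.val_inj]

variable {Γ}

/-- Inside a gadget the numbering is injective, because `a ≠ b` and both lie below the new numbers.
Different gadgets are separated by the second ends of their edges, which are always new vertices. -/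
theorem Valid.nodup_expand (hΓ : Γ.Valid) (hl : ∀ e ∈ l, e.1 < n ∧ e.2 < n)
    (hne : ∀ e ∈ l, e.1 ≠ e.2) : (Γ.expand n l).Nodup := by
  induction l generalizing n with
  | nil => exact List.nodup_nil
  | cons e l ih =>
    have he := hl e List.mem_cons_self
    have hne' := hne e List.mem_cons_self
    rw [expand, List.nodup_append', List.nodup_reverse, List.disjoint_reverse_right]
    refine ⟨ih (fun f hf => ?_) (fun f hf => hne f (List.mem_cons_of_mem _ hf)), ?_, ?_⟩
    · have := hl f (List.mem_cons_of_mem _ hf)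
      omega
    · refine hΓ.nodup.map_on ?_
      rintro ⟨s, j⟩ _ ⟨s', j'⟩ _ h
      rw [Prod.mk.injEq] at h
      obtain ⟨h1, h2⟩ := h
      have : j = j' := Fin.ext (by simpa using h2)
      subst this
      rcases s with (_ | _) | k <;> rcases s' with (_ | _) | k' <;>
        simp only [number] at h1 <;> first | rfl | omega | skip
      rw [Fin.ext (Nat.add_left_cancel h1)]
    · intro x hx hx'
      obtain ⟨i, hi⟩ := (mem_expand_iff Γ _ _ _).1 hx
      obtain ⟨f, _, rfl⟩ := List.mem_map.1 hi
      obtain ⟨f', _, h⟩ := List.mem_map.1 hx'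
      have h2 := congrArg Prod.snd h
      have := f'.2.isLt
      simp only at h2
      omega

theorem Valid.ne_of_mem_expand (hΓ : Γ.Valid) (hl : ∀ e ∈ l, e.1 < n ∧ e.2 < n)
    {x : ℕ × ℕ} (hx : x ∈ Γ.expand n l) : x.1 ≠ x.2 := by
  obtain ⟨i, ⟨s, j⟩, he, rfl⟩ := (mem_expand Γ hl).1 hx
  intro h
  have h := (numbering K n l.length).injective (Fin.ext h)
  obtain ⟨-, h⟩ := loc_eq_inr h
  exact hΓ.ne j j (h ▸ he) rfl

theorem bound_of_mem_expand (hl : ∀ e ∈ l, e.1 < n ∧ e.2 < n) {x : ℕ × ℕ}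
    (hx : x ∈ Γ.expand n l) :
    x.1 < n + K * l.length ∧ x.2 < n + K * l.length := by
  obtain ⟨i, e, he, rfl⟩ := (mem_expand Γ hl).1 hx
  exact ⟨Fin.isLt _, Fin.isLt _⟩

/-- The graph in which the pairs of a list are replaced by gadgets. -/
def Valid.graphCode (hΓ : Γ.Valid) (n : ℕ) (l : List (ℕ × ℕ))
    (hl : ∀ e ∈ l, e.1 < n ∧ e.2 < n) (hne : ∀ e ∈ l, e.1 ≠ e.2) : GraphCode where
  n := n + K * l.length
  edges := Γ.expand n l
  bound _ := bound_of_mem_expand hl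
  loopless _ := hΓ.ne_of_mem_expand hl
  oneDirection x hx hx' := by
    obtain ⟨i, ⟨s, j⟩, he, rfl⟩ := (mem_expand Γ hl).1 hx
    obtain ⟨i', ⟨s', j'⟩, he', h₁, h₂⟩ := (numbering_mem_expand Γ hl _ _).1 hx'
    obtain ⟨-, h₁⟩ := loc_eq_inr h₁
    obtain ⟨-, h₂⟩ := loc_eq_inr h₂.symm
    exact hΓ.asymm j' j (h₂ ▸ he) (h₁ ▸ he')
  nodup := hΓ.nodup_expand hl hne

/-- The poset in which the pairs of a list are replaced by gadgets. -/
def Valid.posetCode (hΓ : Γ.Valid) (hΓ' : Γ.Bipartite) (n : ℕ) (l : List (ℕ × ℕ))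
    (hl : ∀ e ∈ l, e.1 < n ∧ e.2 < n) (hne : ∀ e ∈ l, e.1 ≠ e.2) : PosetCode where
  n := n + K * l.length
  pairs := Γ.expand n l
  bound _ := bound_of_mem_expand hl
  irrefl _ := hΓ.ne_of_mem_expand hl
  trans a b c hab hbc := by
    -- No pair starts where another one ends, so transitivity is vacuous.
    exfalso
    obtain ⟨i, ⟨s, j⟩, he, h⟩ := (mem_expand Γ hl).1 hab
    obtain ⟨i', ⟨s', j'⟩, he', h'⟩ := (mem_expand Γ hl).1 hbc
    rw [Prod.mk.injEq] at h h'
    have h := (numbering K n l.length).injective (Fin.ext (h'.1.trans h.2.symm))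
    obtain ⟨-, h⟩ := loc_eq_inr h
    exact hΓ' j j' s (h ▸ he') he
  nodup := hΓ.nodup_expand hl hne

theorem Valid.graphCode_adj (hΓ : Γ.Valid) {hl : ∀ e ∈ l, e.1 < n ∧ e.2 < n}
    {hne : ∀ e ∈ l, e.1 ≠ e.2} (x y : Fin n ⊕ (Fin l.length × Fin K)) :
    (hΓ.graphCode n l hl hne).graph.Adj (numbering K n l.length x) (numbering K n l.length y) ↔
      (∃ i : Fin l.length, ∃ e ∈ Γ.edges, loc hl i e.1 = x ∧ .inr (i, e.2) = y) ∨
      ∃ i : Fin l.length, ∃ e ∈ Γ.edges, loc hl i e.1 = y ∧ .inr (i, e.2) = x :=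
  or_congr (numbering_mem_expand Γ hl x y) (numbering_mem_expand Γ hl y x)

theorem Valid.posetCode_lt (hΓ : Γ.Valid) (hΓ' : Γ.Bipartite)
    {hl : ∀ e ∈ l, e.1 < n ∧ e.2 < n} {hne : ∀ e ∈ l, e.1 ≠ e.2}
    (x y : Fin n ⊕ (Fin l.length × Fin K)) :
    (hΓ.posetCode hΓ' n l hl hne).Lt (numbering K n l.length x) (numbering K n l.length y) ↔
      ∃ i : Fin l.length, ∃ e ∈ Γ.edges, loc hl i e.1 = x ∧ .inr (i, e.2) = y :=
  numbering_mem_expand Γ hl x y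

end Gadget

end Expansion

/-! ### Paths of length eight: codes of `C_Y` and `P_Y` -/

section PathGadget

instance {K : ℕ} (x : (Bool ⊕ Fin K) × Fin K) (l : List ((Bool ⊕ Fin K) × Fin K)) :
    Decidable (x ∈ l) :=
  @List.instDecidableMemOfLawfulBEq _ instBEqOfDecidableEq inferInstance x l

/-- The path `a - 0 - 1 - 2 - 3 - 4 - 5 - 6 - b`. -/
def pathGadget : Gadget 7 where
  edges := [(.inl false, 0), (.inr 1, 0), (.inr 1, 2), (.inr 3, 2), (.inr 3, 4), (.inr 5, 4),
    (.inr 5, 6), (.inl true, 6)]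

theorem pathGadget_valid : pathGadget.Valid where
  nodup := by decide
  ne := by decide
  asymm := by decide

/-- All edges are directed towards the new vertices with even number, which are the maximal elements
`q`, and none starts there. -/
theorem pathGadget_bipartite : pathGadget.Bipartite := by
  unfold Gadget.Bipartite
  decide

namespace GraphCode

variable (c : GraphCode)

/-- The ends of the `i`-th edge. -/
def vert (i : Fin c.edges.length) : Bool → Fin c.n
  | false => ⟨c.edges[i].1, (c.bound _ (List.getElem_mem _)).1⟩
  | true => ⟨c.edges[i].2, (c.bound _ (List.getElem_mem _)).2⟩

theorem vert_ne (i : Fin c.edges.length) : c.vert i false ≠ c.vert i true := fun h =>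
  c.loopless _ (List.getElem_mem i.isLt) (congrArg Fin.val h)

/-- The `i`-th edge. -/
def edge (i : Fin c.edges.length) : c.graph.edgeSet :=
  ⟨s(c.vert i false, c.vert i true), Or.inl (List.getElem_mem i.isLt)⟩

theorem vert_mem_edge (i : Fin c.edges.length) (β : Bool) :
    c.vert i β ∈ (c.edge i : Sym2 (Fin c.n)) := by
  cases β <;> simp [edge]

/-- For injectivity, `nodup` excludes that an edge is listed twice in the same direction, and
`oneDirection` that it is listed in both. -/
theorem edge_bijective : Function.Bijective c.edge := by
  constructor
  · intro i j h
    have h := congrArg Subtype.val h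
    simp only [edge, Sym2.eq_iff] at h
    rcases h with ⟨h1, h2⟩ | ⟨h1, h2⟩
    · exact c.nodup.injective_get (Prod.ext (congrArg Fin.val h1) (congrArg Fin.val h2))
    · refine (c.oneDirection _ (List.getElem_mem i.isLt) ?_).elim
      have : (c.edges[i].2, c.edges[i].1) = c.edges[j] :=
        Prod.ext (congrArg Fin.val h2) (congrArg Fin.val h1)
      exact this ▸ List.getElem_mem j.isLt
  · rintro ⟨e, he⟩
    induction e with
    | _ a b =>
      rcases he with he | he <;> obtain ⟨i, hi, h⟩ := List.getElem_of_mem he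
      · exact ⟨⟨i, hi⟩, Subtype.ext (Sym2.eq_iff.2 (.inl
          ⟨Fin.ext (congrArg Prod.fst h), Fin.ext (congrArg Prod.snd h)⟩))⟩
      · exact ⟨⟨i, hi⟩, Subtype.ext (Sym2.eq_iff.2 (.inr
          ⟨Fin.ext (congrArg Prod.fst h), Fin.ext (congrArg Prod.snd h)⟩))⟩

/-- The edges of the incidence graph. -/
def incidence (i : Fin c.edges.length) (β : Bool) : (incidenceGraph c.graph).edgeSet :=
  ⟨s(.inl (c.vert i β), .inr (c.edge i)), c.vert_mem_edge i β⟩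

theorem incidence_inj {i j : Fin c.edges.length} {β γ : Bool} :
    c.incidence i β = c.incidence j γ ↔ i = j ∧ β = γ := by
  refine ⟨fun h => ?_, by rintro ⟨rfl, rfl⟩; rfl⟩
  have h := congrArg Subtype.val h
  simp only [incidence, Sym2.eq_iff, Sum.inl.injEq, Sum.inr.injEq, reduceCtorEq, false_and,
    or_false] at h
  obtain ⟨h1, h2⟩ := h
  have := c.edge_bijective.1 h2
  subst this
  refine ⟨rfl, ?_⟩
  have := c.vert_ne i
  cases β <;> cases γ <;> simp_all

theorem exists_incidence (e : (incidenceGraph c.graph).edgeSet) : ∃ i β, e = c.incidence i β := by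
  have key : ∀ v (f : c.graph.edgeSet), v ∈ (f : Sym2 (Fin c.n)) →
      ∃ i β, v = c.vert i β ∧ f = c.edge i := by
    intro v f h
    obtain ⟨i, rfl⟩ := c.edge_bijective.2 f
    rcases Sym2.mem_iff.1 h with h | h
    exacts [⟨i, false, h, rfl⟩, ⟨i, true, h, rfl⟩]
  obtain ⟨e, he⟩ := e
  induction e with
  | _ a b =>
    rcases a with a | a <;> rcases b with b | b
    · exact he.elim
    · obtain ⟨i, β, rfl, rfl⟩ := key a b he
      exact ⟨i, β, rfl⟩
    · obtain ⟨i, β, rfl, rfl⟩ := key b a he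
      exact ⟨i, β, Subtype.ext Sym2.eq_swap⟩
    · exact he.elim

theorem inl_mem_incidence (i : Fin c.edges.length) (β : Bool) :
    Sum.inl (c.vert i β) ∈ (c.incidence i β : Sym2 (Fin c.n ⊕ c.graph.edgeSet)) :=
  Sym2.mem_mk_left _ _

theorem inr_mem_incidence (i : Fin c.edges.length) (β : Bool) :
    Sum.inr (c.edge i) ∈ (c.incidence i β : Sym2 (Fin c.n ⊕ c.graph.edgeSet)) :=
  Sym2.mem_mk_right _ _

/-- The vertices of `C_Y` that belong to the vertices of a path. -/
def toPathVert : Fin c.n ⊕ (Fin c.edges.length × Fin 7) → PathVert (incidenceGraph c.graph)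
  | .inl v => .p (.inl v)
  -- From one end of the edge to the other, the path runs through `q`, `r`, `q` of the first
  -- incidence, the vertex `p` of the edge itself, and `q`, `r`, `q` of the second incidence.
  | .inr (i, 0) => .q _ _ (c.inl_mem_incidence i false)
  | .inr (i, 1) => .r (c.incidence i false)
  | .inr (i, 2) => .q _ _ (c.inr_mem_incidence i false)
  | .inr (i, 3) => .p (.inr (c.edge i))
  | .inr (i, 4) => .q _ _ (c.inr_mem_incidence i true)
  | .inr (i, 5) => .r (c.incidence i true)
  | .inr (i, 6) => .q _ _ (c.inl_mem_incidence i true)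

theorem toPathVert_bijective : Function.Bijective c.toPathVert := by
  constructor
  · rintro (v | ⟨i, j⟩) (w | ⟨i', j'⟩) h
    · simpa [toPathVert] using h
    · fin_cases j' <;> simp [toPathVert] at h
    · fin_cases j <;> simp [toPathVert] at h
    · fin_cases j <;> fin_cases j' <;>
        simp [toPathVert, incidence_inj, c.edge_bijective.1.eq_iff] at h ⊢ <;> simp [h]
  · rintro ((v | e) | ⟨v, e, h⟩ | e)
    · exact ⟨.inl v, rfl⟩
    · obtain ⟨i, rfl⟩ := c.edge_bijective.2 e
      exact ⟨.inr (i, 3), rfl⟩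
    · obtain ⟨i, β, rfl⟩ := c.exists_incidence e
      rcases Sym2.mem_iff.1 h with rfl | rfl <;> cases β
      exacts [⟨.inr (i, 0), rfl⟩, ⟨.inr (i, 6), rfl⟩, ⟨.inr (i, 2), rfl⟩, ⟨.inr (i, 4), rfl⟩]
    · obtain ⟨i, β, rfl⟩ := c.exists_incidence e
      cases β
      exacts [⟨.inr (i, 1), rfl⟩, ⟨.inr (i, 5), rfl⟩]

/-- An edge of `X` has two incidences, each of which is an edge of `Y` with two ends; each of these
four ends contributes a relation `p < q` and a relation `r < q`. These are the eight edges of the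
gadget. -/
theorem toPathVert_lt (x y : Fin c.n ⊕ (Fin c.edges.length × Fin 7)) :
    PathLt (incidenceGraph c.graph) (c.toPathVert x) (c.toPathVert y) ↔
      ∃ i : Fin c.edges.length, ∃ e ∈ pathGadget.edges,
        Gadget.loc c.bound i e.1 = x ∧ .inr (i, e.2) = y := by
  constructor
  · have key : ∀ u w, PathLt (incidenceGraph c.graph) u w →
        ∃ i : Fin c.edges.length, ∃ e ∈ pathGadget.edges,
          u = c.toPathVert (Gadget.loc c.bound i e.1) ∧ w = c.toPathVert (.inr (i, e.2)) := by
      rintro _ _ (⟨v, e, h⟩ | ⟨v, e, h⟩)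
      all_goals
        obtain ⟨i, β, rfl⟩ := c.exists_incidence e
        refine ⟨i, ?_⟩
      · rcases Sym2.mem_iff.1 h with rfl | rfl <;> cases β
        · exact ⟨(.inl false, 0), by decide, rfl, rfl⟩
        · exact ⟨(.inl true, 6), by decide, rfl, rfl⟩
        · exact ⟨(.inr 3, 2), by decide, rfl, rfl⟩
        · exact ⟨(.inr 3, 4), by decide, rfl, rfl⟩
      · rcases Sym2.mem_iff.1 h with rfl | rfl <;> cases β
        · exact ⟨(.inr 1, 0), by decide, rfl, rfl⟩
        · exact ⟨(.inr 5, 6), by decide, rfl, rfl⟩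
        · exact ⟨(.inr 1, 2), by decide, rfl, rfl⟩
        · exact ⟨(.inr 5, 4), by decide, rfl, rfl⟩
    intro h
    obtain ⟨i, e, he, h1, h2⟩ := key _ _ h
    exact ⟨i, e, he, (c.toPathVert_bijective.1 h1).symm, (c.toPathVert_bijective.1 h2).symm⟩
  · rintro ⟨i, e, he, rfl, rfl⟩
    simp only [pathGadget, List.mem_cons, List.not_mem_nil, or_false] at he
    rcases he with rfl | rfl | rfl | rfl | rfl | rfl | rfl | rfl
    exacts [.pq _ _ _, .rq _ _ _, .rq _ _ _, .pq _ _ _, .pq _ _ _, .rq _ _ _, .rq _ _ _,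
      .pq _ _ _]

/-- A code of `C_Y`, for the incidence graph `Y`. -/
def pathGraph : GraphCode := pathGadget_valid.graphCode c.n c.edges c.bound c.loopless

/-- A code of `P_Y`, for the incidence graph `Y`. -/
def pathPoset : PosetCode :=
  pathGadget_valid.posetCode pathGadget_bipartite c.n c.edges c.bound c.loopless

/-- The numbering of the vertices of `C_Y`. -/
noncomputable def pathEquiv :
    Fin (c.n + 7 * c.edges.length) ≃ PathVert (incidenceGraph c.graph) :=
  (Gadget.numbering 7 c.n c.edges.length).symm.trans (Equiv.ofBijective _ c.toPathVert_bijective)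

theorem pathEquiv_lt (x y : Fin (c.n + 7 * c.edges.length)) :
    PathLt (incidenceGraph c.graph) (c.pathEquiv x) (c.pathEquiv y) ↔ c.pathPoset.Lt x y := by
  obtain ⟨x, rfl⟩ := (Gadget.numbering 7 c.n c.edges.length).surjective x
  obtain ⟨y, rfl⟩ := (Gadget.numbering 7 c.n c.edges.length).surjective y
  simp only [pathEquiv, Equiv.trans_apply, Equiv.symm_apply_apply, Equiv.ofBijective_apply]
  rw [toPathVert_lt]
  exact (pathGadget_valid.posetCode_lt pathGadget_bipartite x y).symm

theorem nonempty_pathGraph_iso :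
    Nonempty (c.pathGraph.graph ≃g edgePathGraph (incidenceGraph c.graph)) :=
  ⟨⟨c.pathEquiv, or_congr (c.pathEquiv_lt _ _) (c.pathEquiv_lt _ _)⟩⟩

theorem nonempty_pathPoset_iso :
    Nonempty (c.pathPoset.Carrier ≃o PathVert (incidenceGraph c.graph)) :=
  ⟨⟨c.pathEquiv, or_congr c.pathEquiv.injective.eq_iff (c.pathEquiv_lt _ _)⟩⟩

end GraphCode

end PathGadget

/-! ### Reduction of poset isomorphism to graph isomorphism -/

section CliqueGadget

/-- A complete graph with four vertices, one of which is adjacent to `a`, and two to `b`. -/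
def cliqueGadget : Gadget 4 where
  edges := [(.inl false, 0), (.inl true, 1), (.inl true, 2), (.inr 0, 1), (.inr 0, 2),
    (.inr 0, 3), (.inr 1, 2), (.inr 1, 3), (.inr 2, 3)]

theorem cliqueGadget_valid : cliqueGadget.Valid where
  nodup := by decide
  ne := by decide
  asymm := by decide

variable {P Q : Type*} [PartialOrder P] [PartialOrder Q]

/-- The adjacency relation of the graph that arises from a poset by gluing a clique to every
related pair. -/
def cliqueAdj : P ⊕ ({x : P × P // x.1 < x.2} × Fin 4) → P ⊕ ({x : P × P // x.1 < x.2} × Fin 4) →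
    Prop
  | .inl _, .inl _ => False
  | .inl a, .inr (x, j) => a = x.1.1 ∧ j = 0 ∨ a = x.1.2 ∧ (j = 1 ∨ j = 2)
  | .inr (x, j), .inl a => a = x.1.1 ∧ j = 0 ∨ a = x.1.2 ∧ (j = 1 ∨ j = 2)
  | .inr (x, i), .inr (y, j) => x = y ∧ i ≠ j

variable (P) in
/-- The graph that arises from a poset by gluing a clique to every related pair. -/
def cliqueGraph : SimpleGraph (P ⊕ ({x : P × P // x.1 < x.2} × Fin 4)) where
  Adj := cliqueAdj
  symm := ⟨by
    rintro (a | ⟨x, i⟩) (b | ⟨y, j⟩) h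
    · exact h
    · exact h
    · exact h
    · exact ⟨h.1.symm, h.2.symm⟩⟩
  loopless := ⟨by
    rintro (a | ⟨x, i⟩) h
    · exact h
    · exact h.2 rfl⟩

/-- Isomorphic posets have isomorphic clique graphs. -/
def cliqueGraphIso (φ : P ≃o Q) : cliqueGraph P ≃g cliqueGraph Q where
  toEquiv := φ.toEquiv.sumCongr
    (((φ.toEquiv.prodCongr φ.toEquiv).subtypeEquiv fun _ => φ.lt_iff_lt.symm).prodCongr
      (Equiv.refl _))
  map_rel_iff' := by
    rintro (a | ⟨x, i⟩) (b | ⟨y, j⟩)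
    · exact Iff.rfl
    · exact or_congr (and_congr_left' φ.injective.eq_iff) (and_congr_left' φ.injective.eq_iff)
    · exact or_congr (and_congr_left' φ.injective.eq_iff) (and_congr_left' φ.injective.eq_iff)
    · exact and_congr_left' (Equiv.injective _).eq_iff

theorem eq_inr_of_adj_inl {a : P} {w} (h : (cliqueGraph P).Adj (.inl a) w) :
    ∃ x j, w = .inr (x, j) ∧ (a = x.1.1 ∧ j = 0 ∨ a = x.1.2 ∧ (j = 1 ∨ j = 2)) := by
  rcases w with b | ⟨x, j⟩
  · exact h.elim
  · exact ⟨x, j, rfl, h⟩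

/-- A triangle of neighbours of old vertices lies in one clique. The vertex `b` meets two of its
vertices, so it is the upper element of the pair and these are the vertices 1 and 2; the third
vertex is then adjacent to `a` only as vertex 0, so `a` is the lower element. Thus the order is
expressed by adjacency alone. -/
theorem lt_iff_cliqueGraph (a b : P) : a < b ↔
    ∃ x y z, (cliqueGraph P).Adj (.inl a) x ∧ (cliqueGraph P).Adj (.inl b) y ∧
      (cliqueGraph P).Adj (.inl b) z ∧ (cliqueGraph P).Adj x y ∧ (cliqueGraph P).Adj x z ∧
      (cliqueGraph P).Adj y z := by
  constructor
  · intro h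
    refine ⟨.inr (⟨(a, b), h⟩, 0), .inr (⟨(a, b), h⟩, 1), .inr (⟨(a, b), h⟩, 2), ?_⟩
    simp [cliqueGraph, cliqueAdj]
  · rintro ⟨x, y, z, hx, hy, hz, hxy, hxz, hyz⟩
    obtain ⟨x, i, rfl, hx⟩ := eq_inr_of_adj_inl hx
    obtain ⟨y, j, rfl, hy⟩ := eq_inr_of_adj_inl hy
    obtain ⟨z, k, rfl, hz⟩ := eq_inr_of_adj_inl hz
    obtain ⟨rfl, hij⟩ := hxy
    obtain ⟨rfl, hik⟩ := hxz
    have hjk := hyz.2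
    have := x.2
    have := this.ne
    grind

/-- The new vertices are those that lie in a complete graph on four vertices: an old vertex has at
most two neighbours in each clique, and no old neighbours. This is what the fourth clique vertex is
for. -/
theorem isInr_iff_cliqueGraph (w : P ⊕ ({x : P × P // x.1 < x.2} × Fin 4)) : w.isRight ↔
    ∃ x y z, (cliqueGraph P).Adj w x ∧ (cliqueGraph P).Adj w y ∧
      (cliqueGraph P).Adj w z ∧ (cliqueGraph P).Adj x y ∧ (cliqueGraph P).Adj x z ∧
      (cliqueGraph P).Adj y z := by
  constructor
  · intro h
    rcases w with a | ⟨x, i⟩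
    · simp at h
    · have : ∃ j k l : Fin 4, i ≠ j ∧ i ≠ k ∧ i ≠ l ∧ j ≠ k ∧ j ≠ l ∧ k ≠ l := by
        clear h; revert i; decide
      obtain ⟨j, k, l, hj, hk, hl, hjk, hjl, hkl⟩ := this
      exact ⟨.inr (x, j), .inr (x, k), .inr (x, l), ⟨rfl, hj⟩, ⟨rfl, hk⟩, ⟨rfl, hl⟩, ⟨rfl, hjk⟩,
        ⟨rfl, hjl⟩, ⟨rfl, hkl⟩⟩
  · rintro ⟨x, y, z, hx, hy, hz, hxy, hxz, hyz⟩
    rcases w with a | w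
    · obtain ⟨x, i, rfl, hx⟩ := eq_inr_of_adj_inl hx
      obtain ⟨y, j, rfl, hy⟩ := eq_inr_of_adj_inl hy
      obtain ⟨z, k, rfl, hz⟩ := eq_inr_of_adj_inl hz
      obtain ⟨rfl, hij⟩ := hxy
      obtain ⟨rfl, hik⟩ := hxz
      have hjk := hyz.2
      have := x.2
      have := this.ne
      grind
    · rfl

theorem isRight_cliqueGraph_iso (ψ : cliqueGraph P ≃g cliqueGraph Q) {w}
    (h : w.isRight) : (ψ w).isRight := by
  rw [isInr_iff_cliqueGraph] at h ⊢
  obtain ⟨x, y, z, h⟩ := h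
  refine ⟨ψ x, ψ y, ψ z, ?_⟩
  simpa only [SimpleGraph.Iso.map_adj_iff] using h

theorem exists_inl_cliqueGraph_iso (ψ : cliqueGraph P ≃g cliqueGraph Q) (a : P) :
    ∃ b, ψ (.inl a) = .inl b := by
  rcases h : ψ (.inl a) with b | b
  · exact ⟨b, rfl⟩
  · have := isRight_cliqueGraph_iso ψ.symm (w := .inr b) rfl
    rw [← h, RelIso.symm_apply_apply] at this
    cases this

/-- Posets with isomorphic clique graphs are isomorphic. -/
theorem nonempty_orderIso_of_cliqueGraph (ψ : cliqueGraph P ≃g cliqueGraph Q) :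
    Nonempty (P ≃o Q) := by
  choose f hf using exists_inl_cliqueGraph_iso ψ
  choose g hg using exists_inl_cliqueGraph_iso ψ.symm
  refine ⟨OrderIso.ofRelIsoLT ⟨⟨f, g, fun a => ?_, fun b => ?_⟩, ?_⟩⟩
  · apply Sum.inl_injective (β := {x : P × P // x.1 < x.2} × Fin 4)
    rw [← hg, ← hf, RelIso.symm_apply_apply]
  · apply Sum.inl_injective (β := {x : Q × Q // x.1 < x.2} × Fin 4)
    rw [← hf, ← hg, RelIso.apply_symm_apply]
  · intro a b
    change f a < f b ↔ a < b
    rw [lt_iff_cliqueGraph, lt_iff_cliqueGraph, ← hf, ← hf]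
    simp only [ψ.surjective.exists, SimpleGraph.Iso.map_adj_iff]

namespace PosetCode

variable (c : PosetCode)

/-- A code of the clique graph of a poset. -/
def cliqueCode : GraphCode := cliqueGadget_valid.graphCode c.n c.pairs c.bound c.irrefl

/-- The pairs of a poset that is given by a code. -/
def pair (i : Fin c.pairs.length) : {x : c.Carrier × c.Carrier // x.1 < x.2} :=
  ⟨(⟨c.pairs[i].1, (c.bound _ (List.getElem_mem _)).1⟩,
    ⟨c.pairs[i].2, (c.bound _ (List.getElem_mem _)).2⟩), List.getElem_mem i.isLt⟩

theorem pair_bijective : Function.Bijective c.pair := by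
  constructor
  · intro i j h
    have h := congrArg Subtype.val h
    have h1 := congrArg (fun x => Fin.val (n := c.n) x.1) h
    have h2 := congrArg (fun x => Fin.val (n := c.n) x.2) h
    exact c.nodup.injective_get (Prod.ext h1 h2)
  · rintro ⟨⟨a, b⟩, h⟩
    obtain ⟨i, hi, h⟩ := List.getElem_of_mem h
    exact ⟨⟨i, hi⟩, Subtype.ext (Prod.ext (Fin.ext (congrArg Prod.fst h))
      (Fin.ext (congrArg Prod.snd h)))⟩

theorem nonempty_cliqueCode_iso : Nonempty (c.cliqueCode.graph ≃g cliqueGraph c.Carrier) := by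
  let E : Fin c.n ⊕ (Fin c.pairs.length × Fin 4) ≃
      c.Carrier ⊕ ({x : c.Carrier × c.Carrier // x.1 < x.2} × Fin 4) :=
    (Equiv.refl (Fin c.n)).sumCongr ((Equiv.ofBijective _ c.pair_bijective).prodCongr
      (Equiv.refl _))
  refine ⟨⟨(Gadget.numbering 4 c.n c.pairs.length).symm.trans E, ?_⟩⟩
  intro x y
  obtain ⟨x, rfl⟩ := (Gadget.numbering 4 c.n c.pairs.length).surjective x
  obtain ⟨y, rfl⟩ := (Gadget.numbering 4 c.n c.pairs.length).surjective y
  refine Iff.trans ?_ (cliqueGadget_valid.graphCode_adj x y).symm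
  have hx : (cliqueGraph c.Carrier).Adj (E x) (E y) ↔
      (∃ i : Fin c.pairs.length, ∃ e ∈ cliqueGadget.edges,
        Gadget.loc c.bound i e.1 = x ∧ .inr (i, e.2) = y) ∨
      ∃ i : Fin c.pairs.length, ∃ e ∈ cliqueGadget.edges,
        Gadget.loc c.bound i e.1 = y ∧ .inr (i, e.2) = x := by
    rcases x with x | ⟨i, j⟩ <;> rcases y with y | ⟨i', j'⟩
    · change False ↔ _
      simp
    · change x = (c.pair i').1.1 ∧ j' = 0 ∨ x = (c.pair i').1.2 ∧ (j' = 1 ∨ j' = 2) ↔ _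
      simp [cliqueGadget, Gadget.loc, pair, eq_comm]
      grind
    · change y = (c.pair i).1.1 ∧ j = 0 ∨ y = (c.pair i).1.2 ∧ (j = 1 ∨ j = 2) ↔ _
      simp [cliqueGadget, Gadget.loc, pair, eq_comm]
      grind
    · change c.pair i = c.pair i' ∧ j ≠ j' ↔ _
      rw [c.pair_bijective.1.eq_iff]
      by_cases h : i = i'
      · subst h
        fin_cases j <;> fin_cases j' <;> simp [cliqueGadget, Gadget.loc]
      · refine iff_of_false (fun h' => h h'.1) ?_
        rintro (⟨k, e, -, h1, h2⟩ | ⟨k, e, -, h1, h2⟩)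
        · exact h ((Gadget.loc_eq_inr h1).1.symm.trans (Prod.mk.inj (Sum.inr.inj h2)).1)
        · exact h ((Prod.mk.inj (Sum.inr.inj h2)).1.symm.trans (Gadget.loc_eq_inr h1).1)
  have hE : ∀ z, ((Gadget.numbering 4 c.n c.pairs.length).symm.trans E)
      (Gadget.numbering 4 c.n c.pairs.length z) = E z := by simp
  exact (iff_of_eq (congrArg₂ (cliqueGraph c.Carrier).Adj (hE x) (hE y))).trans hx

end PosetCode

end CliqueGadget

universe u v

/-! ### Four linear orders that realize `P_X` -/

section Dim

variable {V : Type u} {X : SimpleGraph V}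

theorem pathVert_le_iff (x y : PathVert X) : x ≤ y ↔ x = y ∨ PathLt X x y := Iff.rfl

theorem not_pathLt_p (x : PathVert X) (v : V) : ¬ PathLt X x (.p v) := nofun

theorem not_pathLt_r (x : PathVert X) (e : X.edgeSet) : ¬ PathLt X x (.r e) := nofun

theorem not_pathLt_of_q (x : PathVert X) (v : V) (e : X.edgeSet) (h) :
    ¬ PathLt X (.q v e h) x := nofun

theorem pathLt_p_q (v w : V) (e : X.edgeSet) (h) : PathLt X (.p v) (.q w e h) ↔ v = w :=
  ⟨fun h => by cases h; rfl, by rintro rfl; exact .pq _ _ _⟩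

theorem pathLt_r_q (w : V) (e f : X.edgeSet) (h) : PathLt X (.r f) (.q w e h) ↔ f = e :=
  ⟨fun h => by cases h; rfl, by rintro rfl; exact .rq _ _ _⟩

/-- An order in which all elements `p` come first, and every `q` follows closely upon its `r`. -/
def keyP (a : V → ℤ) (b : X.edgeSet → ℤ) : PathVert X → ℤ ×ₗ ℤ ×ₗ ℤ ×ₗ ℤ
  | .p v => toLex (0, toLex (a v, toLex (0, 0)))
  | .r e => toLex (1, toLex (b e, toLex (0, 0)))
  | .q v e _ => toLex (1, toLex (b e, toLex (1, a v)))

/-- An order in which all elements `r` come first, and every `q` follows closely upon its `p`. -/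
def keyR (a : V → ℤ) (b : X.edgeSet → ℤ) : PathVert X → ℤ ×ₗ ℤ ×ₗ ℤ ×ₗ ℤ
  | .r e => toLex (0, toLex (b e, toLex (0, 0)))
  | .p v => toLex (1, toLex (a v, toLex (0, 0)))
  | .q v e _ => toLex (1, toLex (a v, toLex (1, b e)))

variable {a : V → ℤ} {b : X.edgeSet → ℤ}

theorem keyP_injective (ha : a.Injective) (hb : b.Injective) : (keyP (X := X) a b).Injective := by
  rintro (v | ⟨v, e, h⟩ | e) (w | ⟨w, f, h'⟩ | f) H <;>
    simp [keyP, ha.eq_iff, hb.eq_iff] at H ⊢ <;> simp [H]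

theorem keyR_injective (ha : a.Injective) (hb : b.Injective) : (keyR (X := X) a b).Injective := by
  rintro (v | ⟨v, e, h⟩ | e) (w | ⟨w, f, h'⟩ | f) H <;>
    simp [keyR, ha.eq_iff, hb.eq_iff] at H ⊢ <;> simp [H]

/-- `keyP` and `keyR` put a `p` and an `r` in opposite orders. Every other incomparable pair is
compared in one of them by its `a` or `b` values: `q_{v,e}` and `r_f` by `b` in `keyP`, `q_{v,e}`
and `p_w` by `a` in `keyR`, two elements of the same kind in either. Negating `a` and `b` reverses
that comparison. The relations `p < q` and `r < q` hold in all four orders. -/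
theorem hasRealizer_pathVert [Finite V] : HasRealizer (PathVert X) 4 := by
  obtain ⟨a', ha'⟩ := Countable.exists_injective_nat V
  obtain ⟨b', hb'⟩ := Countable.exists_injective_nat X.edgeSet
  set a : V → ℤ := fun v => a' v with ha
  set b : X.edgeSet → ℤ := fun v => b' v with hb
  have ha1 : a.Injective := Nat.cast_injective.comp ha'
  have hb1 : b.Injective := Nat.cast_injective.comp hb'
  clear_value a b
  have ha2 : (-a).Injective := neg_injective.comp ha1
  have hb2 : (-b).Injective := neg_injective.comp hb1
  refine ⟨![LinearOrder.lift' _ (keyP_injective ha1 hb1), LinearOrder.lift' _ (keyR_injective ha1 hb1),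
    LinearOrder.lift' _ (keyP_injective ha2 hb2), LinearOrder.lift' _ (keyR_injective ha2 hb2)], ?_⟩
  intro x y
  have : (∀ i : Fin 4, ((![LinearOrder.lift' _ (keyP_injective ha1 hb1),
      LinearOrder.lift' _ (keyR_injective ha1 hb1), LinearOrder.lift' _ (keyP_injective ha2 hb2),
      LinearOrder.lift' _ (keyR_injective ha2 hb2)] : Fin 4 → LinearOrder (PathVert X)) i).le x y) ↔
      keyP a b x ≤ keyP a b y ∧ keyR a b x ≤ keyR a b y ∧ keyP (-a) (-b) x ≤ keyP (-a) (-b) y ∧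
      keyR (-a) (-b) x ≤ keyR (-a) (-b) y := by
    simp only [Fin.forall_fin_succ]
    simp
    rfl
  rw [this, pathVert_le_iff]
  have hae : ∀ v w, v = w ↔ a v = a w := fun v w => ha1.eq_iff.symm
  have hbe : ∀ v w, v = w ↔ b v = b w := fun v w => hb1.eq_iff.symm
  rcases x with v | ⟨v, e, h⟩ | e <;> rcases y with w | ⟨w, f, h'⟩ | f <;>
    simp only [keyP, keyR, not_pathLt_p, not_pathLt_r, not_pathLt_of_q, pathLt_p_q, pathLt_r_q,
      Prod.Lex.toLex_le_toLex, Pi.neg_apply, or_false, reduceCtorEq, false_or, PathVert.p.injEq,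
      PathVert.q.injEq, PathVert.r.injEq, hae, hbe, lt_irrefl, true_and] <;>
    first | omega | (norm_num; try omega)

theorem orderDim_le_of_hasRealizer {α : Type u} [PartialOrder α] {k : ℕ} (h : HasRealizer α k) :
    orderDim α ≤ k := iInf₂_le k h

theorem orderDim_pathVert_le [Finite V] {k : ℕ} (hk : 4 ≤ k) : orderDim (PathVert X) ≤ k :=
  (orderDim_le_of_hasRealizer hasRealizer_pathVert).trans (by exact_mod_cast hk)

theorem isTransitiveOrientation_edgePathOrder :
    IsTransitiveOrientation (edgePathGraph X) (edgePathOrder X) := fun _ _ => Iff.rfl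

theorem inDim_edgePathGraph [Finite V] {k : ℕ} (hk : 4 ≤ k) : InDim k (edgePathGraph X) :=
  ⟨⟨_, isTransitiveOrientation_edgePathOrder⟩,
    (iInf₂_le _ isTransitiveOrientation_edgePathOrder).trans (orderDim_pathVert_le hk)⟩

end Dim

/-! ### Invariance of the dimension under isomorphism -/

section Transfer

theorem HasRealizer.of_orderIso {α : Type u} {β : Type v} [PartialOrder α] [PartialOrder β]
    {k : ℕ} (φ : α ≃o β) (h : HasRealizer β k) : HasRealizer α k := by
  obtain ⟨L, hL⟩ := h
  refine ⟨fun i => @LinearOrder.lift' _ _ (L i) φ φ.injective, fun x y => ?_⟩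
  rw [← φ.le_iff_le, hL]
  rfl

theorem orderDim_congr {α : Type u} {β : Type v} [PartialOrder α] [PartialOrder β]
    (φ : α ≃o β) : orderDim α = orderDim β :=
  le_antisymm (le_iInf₂ fun k h => iInf₂_le k (h.of_orderIso φ))
    (le_iInf₂ fun k h => iInf₂_le k (h.of_orderIso φ.symm))

theorem InDim.of_iso {V : Type u} {W : Type v} {X : SimpleGraph V} {Y : SimpleGraph W}
    {k : ℕ} (φ : X ≃g Y) (h : InDim k Y) : InDim k X := by
  have key : ∀ P : PartialOrder W, IsTransitiveOrientation Y P →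
      ∃ P' : PartialOrder V, IsTransitiveOrientation X P' ∧ @orderDim V P' = @orderDim W P := by
    intro P hP
    refine ⟨PartialOrder.lift φ φ.injective, fun x y => ?_, ?_⟩
    · rw [← φ.map_adj_iff]
      exact hP _ _
    · exact @orderDim_congr V W (PartialOrder.lift φ φ.injective) P ⟨φ.toEquiv, Iff.rfl⟩
  obtain ⟨⟨P, hP⟩, h⟩ := h
  obtain ⟨P', hP', -⟩ := key P hP
  refine ⟨⟨P', hP'⟩, le_trans (le_iInf₂ fun P hP => ?_) h⟩
  obtain ⟨P', hP', h⟩ := key P hP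
  exact (iInf₂_le P' hP').trans h.le

end Transfer

/-! ### Functoriality of `P_X`, and `C_X` as an iterated incidence graph -/

section Functor

variable {V : Type u} {W : Type v} {X : SimpleGraph V} {Y : SimpleGraph W}

theorem mem_mapEdgeSet (φ : X ≃g Y) {x : V} {e : X.edgeSet} (h : x ∈ (e : Sym2 V)) :
    φ x ∈ (φ.mapEdgeSet e : Sym2 W) := Sym2.mem_map.2 ⟨x, h, rfl⟩

/-- The map between the posets `P_X` and `P_Y` that belongs to an isomorphism of `X` and `Y`. -/
def pathMap (φ : X ≃g Y) : PathVert X → PathVert Y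
  | .p v => .p (φ v)
  | .q v e h => .q (φ v) (φ.mapEdgeSet e) (mem_mapEdgeSet φ h)
  | .r e => .r (φ.mapEdgeSet e)

theorem pathMap_symm_pathMap (φ : X ≃g Y) (x : PathVert X) : pathMap φ.symm (pathMap φ x) = x := by
  have h : ∀ e, φ.symm.mapEdgeSet (φ.mapEdgeSet e) = e := φ.mapEdgeSet.symm_apply_apply
  cases x <;> simp only [pathMap, h, RelIso.symm_apply_apply]

theorem PathLt.pathMap (φ : X ≃g Y) {x y : PathVert X} (h : PathLt X x y) :
    PathLt Y (pathMap φ x) (pathMap φ y) := by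
  cases h
  · exact .pq _ _ _
  · exact .rq _ _ _

/-- Isomorphic graphs `X` and `Y` have isomorphic posets `P_X` and `P_Y`. -/
def pathOrderIso (φ : X ≃g Y) : PathVert X ≃o PathVert Y where
  toFun := pathMap φ
  invFun := pathMap φ.symm
  left_inv := pathMap_symm_pathMap φ
  right_inv := pathMap_symm_pathMap φ.symm
  map_rel_iff' {x y} := by
    have hφ : ∀ z, (⟨pathMap φ, pathMap φ.symm, pathMap_symm_pathMap φ,
      pathMap_symm_pathMap φ.symm⟩ : PathVert X ≃ PathVert Y) z = pathMap φ z := fun _ => rfl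
    refine or_congr ⟨fun h => ?_, congrArg _⟩ ⟨fun h => ?_, PathLt.pathMap φ⟩
    · have := congrArg (pathMap φ.symm) h
      rwa [hφ, hφ, pathMap_symm_pathMap, pathMap_symm_pathMap] at this
    · have := h.pathMap φ.symm
      rwa [hφ, hφ, pathMap_symm_pathMap, pathMap_symm_pathMap] at this

/-- An isomorphism of the posets `P_X` and `P_Y` as an isomorphism of the graphs. -/
def edgePathGraphIso (ψ : PathVert X ≃o PathVert Y) : edgePathGraph X ≃g edgePathGraph Y :=
  ⟨ψ.toEquiv, or_congr ψ.lt_iff_lt ψ.lt_iff_lt⟩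

/-- The graph `C_X` arises from `X` by forming the incidence graph twice. -/
theorem nonempty_edgePathGraph_iso (X : SimpleGraph V) :
    Nonempty (edgePathGraph X ≃g incidenceGraph (incidenceGraph X)) := by
  let F : PathVert X → (V ⊕ X.edgeSet) ⊕ (incidenceGraph X).edgeSet
    | .p v => .inl (.inl v)
    | .r e => .inl (.inr e)
    | .q v e h => .inr ⟨s(.inl v, .inr e), h⟩
  have hF : F.Bijective := by
    constructor
    · rintro (v | ⟨v, e, h⟩ | e) (w | ⟨w, f, h'⟩ | f) H <;> simp [F] at H ⊢ <;>
        simpa [Subtype.ext_iff] using H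
    · rintro ((v | e) | ⟨e, he⟩)
      · exact ⟨.p v, rfl⟩
      · exact ⟨.r e, rfl⟩
      · induction e with
        | _ a b =>
          rcases a with a | a <;> rcases b with b | b
          · exact he.elim
          · exact ⟨.q a b he, rfl⟩
          · exact ⟨.q b a he, congrArg Sum.inr (Subtype.ext Sym2.eq_swap)⟩
          · exact he.elim
  refine ⟨⟨Equiv.ofBijective F hF, ?_⟩⟩
  intro x y
  rw [Equiv.ofBijective_apply, Equiv.ofBijective_apply]
  rcases x with v | ⟨v, e, h⟩ | e <;> rcases y with w | ⟨w, f, h'⟩ | f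
  all_goals
    simp [F, edgePathGraph, incidenceGraph, incidenceAdj, not_pathLt_p, not_pathLt_r,
      not_pathLt_of_q, pathLt_p_q, pathLt_r_q, eq_comm]

end Functor

/-! ### A finite graph is determined by its incidence graph -/

section Cancel

/-- A relation in which every element is related to exactly two others contains a bijection. -/
theorem exists_equiv_of_two_regular {α β : Type*} [Finite α] [Finite β] {r : α → β → Prop}
    (h₁ : ∀ a, ∃ b b', b ≠ b' ∧ ∀ c, r a c ↔ c = b ∨ c = b')
    (h₂ : ∀ b, ∃ a a', a ≠ a' ∧ ∀ c, r c b ↔ c = a ∨ c = a') :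
    ∃ σ : α ≃ β, ∀ a, r a (σ a) := by
  classical
  cases nonempty_fintype α
  cases nonempty_fintype β
  have c₁ : ∀ a, (Finset.univ.filter (r a)).card = 2 := by
    intro a
    obtain ⟨b, b', hb, h⟩ := h₁ a
    rw [← Finset.card_pair hb]
    congr 1
    ext c
    simp [h]
  have c₂ : ∀ b, (Finset.univ.filter fun a => r a b).card = 2 := by
    intro b
    obtain ⟨a, a', ha, h⟩ := h₂ b
    rw [← Finset.card_pair ha]
    congr 1
    ext c
    simp [h]
  -- Hall's condition by double counting: `2 * |A|` related pairs start in `A`, and each neighbour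
  -- of `A` receives at most two of them.
  obtain ⟨f, hf, hr⟩ := (Fintype.all_card_le_filter_rel_iff_exists_injective r).1 (by
    intro A
    have := Finset.card_mul_le_card_mul (s := A) (t := Finset.univ.filter fun b => ∃ a ∈ A, r a b)
      r (m := 2) (n := 2) (fun a ha => ?_) (fun b _ => ?_)
    · omega
    · rw [← c₁ a]
      refine Finset.card_le_card fun b hb => ?_
      simp only [Finset.mem_filter, Finset.mem_univ, true_and, Finset.mem_bipartiteAbove] at hb ⊢
      exact ⟨⟨a, ha, hb⟩, hb⟩
    · rw [← c₂ b]
      exact Finset.card_le_card (Finset.filter_subset_filter _ (Finset.subset_univ _)))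
  have hcard : Fintype.card β ≤ Fintype.card α := by
    have := Finset.card_mul_le_card_mul (s := (Finset.univ : Finset β)) (t := (Finset.univ : Finset α))
      (fun b a => r a b) (m := 2) (n := 2) (fun b _ => (c₂ b).ge) (fun a _ => (c₁ a).le)
    rw [Finset.card_univ, Finset.card_univ] at this
    omega
  exact ⟨Equiv.ofBijective f ((Fintype.bijective_iff_injective_and_card f).2
    ⟨hf, le_antisymm (Fintype.card_le_of_injective f hf) hcard⟩), hr⟩

theorem exists_ends {V : Type*} {X : SimpleGraph V} (e : X.edgeSet) :
    ∃ x y, x ≠ y ∧ ∀ z, z ∈ (e : Sym2 V) ↔ z = x ∨ z = y := by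
  obtain ⟨e, he⟩ := e
  induction e with
  | _ x y => exact ⟨x, y, X.ne_of_adj he, fun z => Sym2.mem_iff⟩

theorem adj_iff_exists_mem {V : Type*} {X : SimpleGraph V} {x y : V} :
    X.Adj x y ↔ x ≠ y ∧ ∃ e : X.edgeSet, x ∈ (e : Sym2 V) ∧ y ∈ (e : Sym2 V) := by
  constructor
  · intro h
    exact ⟨h.ne, ⟨s(x, y), h⟩, Sym2.mem_mk_left _ _, Sym2.mem_mk_right _ _⟩
  · rintro ⟨h, ⟨e, he⟩, hx, hy⟩
    have h' : e = s(x, y) := (Sym2.mem_and_mem_iff h).1 ⟨hx, hy⟩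
    rw [h'] at he
    exact he

variable {V W : Type*} {X : SimpleGraph V} {Y : SimpleGraph W}

theorem adj_iff_incidenceGraph {x y : V} : X.Adj x y ↔
    x ≠ y ∧ ∃ u, (incidenceGraph X).Adj (.inl x) u ∧ (incidenceGraph X).Adj (.inl y) u := by
  rw [adj_iff_exists_mem]
  refine and_congr_right fun _ => ?_
  constructor
  · rintro ⟨e, he⟩
    exact ⟨.inr e, he⟩
  · rintro ⟨u | e, h⟩
    · exact h.1.elim
    · exact ⟨e, h⟩

/-- Finite graphs with isomorphic incidence graphs are isomorphic. -/
theorem nonempty_iso_of_incidenceGraph [Finite V]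
    (φ : incidenceGraph X ≃g incidenceGraph Y) : Nonempty (X ≃g Y) := by
  classical
  -- The vertices that `φ` sends to edges, and below the edges that it sends to vertices. Incident
  -- elements are exchanged together (`hmem`).
  set AV : Set V := {v | (φ (.inl v)).isRight}
  set AE : Set X.edgeSet := {e | (φ (.inr e)).isLeft}
  have hadj : ∀ x y, (incidenceGraph Y).Adj (φ x) (φ y) ↔ (incidenceGraph X).Adj x y :=
    fun x y => φ.map_adj_iff
  have hmem : ∀ {v : V} {e : X.edgeSet}, v ∈ (e : Sym2 V) → (v ∈ AV ↔ e ∈ AE) := by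
    intro v e h
    have h' : (incidenceGraph Y).Adj (φ (.inl v)) (φ (.inr e)) := (hadj _ _).2 h
    revert h'
    change _ → ((φ (.inl v)).isRight = true ↔ (φ (.inr e)).isLeft = true)
    rcases φ (.inl v) with x | x <;> rcases φ (.inr e) with y | y <;> intro h' <;>
      first | exact h'.elim | simp
  -- The image of `v` is an edge of `Y`, and an edge has two ends.
  have hdeg : ∀ v ∈ AV, ∃ e e' : X.edgeSet, e ≠ e' ∧ ∀ f : X.edgeSet,
      v ∈ (f : Sym2 V) ↔ f = e ∨ f = e' := by
    intro v hv
    obtain ⟨g, hg⟩ := Sum.isRight_iff.1 hv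
    obtain ⟨x, y, hxy, h⟩ := exists_ends g
    have key : ∀ z, z ∈ (g : Sym2 W) → ∃ e, φ (.inr e) = .inl z := by
      intro z hz
      have hz' : (incidenceGraph X).Adj (φ.symm (.inr g)) (φ.symm (.inl z)) :=
        φ.symm.map_adj_iff.2 hz
      rw [← hg, RelIso.symm_apply_apply] at hz'
      rcases hw : φ.symm (.inl z) with w | w
      · rw [hw] at hz'
        exact hz'.elim
      · exact ⟨w, by rw [← hw, RelIso.apply_symm_apply]⟩
    obtain ⟨e, he⟩ := key x ((h x).2 (.inl rfl))
    obtain ⟨e', he'⟩ := key y ((h y).2 (.inr rfl))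
    refine ⟨e, e', ?_, fun f => ?_⟩
    · rintro rfl
      exact hxy (Sum.inl_injective (he.symm.trans he'))
    · have h1 : v ∈ (f : Sym2 V) ↔ (incidenceGraph Y).Adj (.inr g) (φ (.inr f)) := by
        rw [← hg, hadj]
        rfl
      rw [h1]
      constructor
      · intro h2
        rcases hz : φ (.inr f) with z | z
        · rw [hz] at h2
          rcases (h z).1 h2 with rfl | rfl
          · exact .inl (Sum.inr_injective (φ.injective (hz.trans he.symm)))
          · exact .inr (Sum.inr_injective (φ.injective (hz.trans he'.symm)))
        · rw [hz] at h2
          exact h2.elim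
      · rintro (rfl | rfl)
        · rw [he]
          exact (h x).2 (.inl rfl)
        · rw [he']
          exact (h y).2 (.inr rfl)
  obtain ⟨σ, hσ⟩ := exists_equiv_of_two_regular (α := AV) (β := AE)
    (r := fun v e => (v : V) ∈ (e.1 : Sym2 V)) (by
      rintro ⟨v, hv⟩
      obtain ⟨e, e', hne, h⟩ := hdeg v hv
      refine ⟨⟨e, (hmem ((h e).2 (.inl rfl))).1 hv⟩, ⟨e', (hmem ((h e').2 (.inr rfl))).1 hv⟩,
        by simpa using hne, fun c => ?_⟩
      rw [h]
      simp [Subtype.ext_iff]) (by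
      rintro ⟨e, he⟩
      obtain ⟨x, y, hne, h⟩ := exists_ends e
      refine ⟨⟨x, (hmem ((h x).2 (.inl rfl))).2 he⟩, ⟨y, (hmem ((h y).2 (.inr rfl))).2 he⟩,
        by simpa using hne, fun c => ?_⟩
      rw [h]
      simp [Subtype.ext_iff])
  -- An exchanged vertex is replaced by its matched edge, so that `φ ∘ τ` takes `V` bijectively to
  -- the vertices of `Y`. Adjacency survives because it means having a common neighbour in the
  -- incidence graph, also after the replacement (`τ_adj`).
  let τ : V → V ⊕ X.edgeSet := fun v => if h : v ∈ AV then .inr (σ ⟨v, h⟩).1 else .inl v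
  have τ_pos : ∀ v (h : v ∈ AV), τ v = .inr (σ ⟨v, h⟩).1 := fun v h => dif_pos h
  have τ_neg : ∀ v, v ∉ AV → τ v = .inl v := fun v h => dif_neg h
  have τ_left : ∀ v, ∃ w, φ (τ v) = .inl w := by
    intro v
    by_cases h : v ∈ AV
    · rw [τ_pos v h]
      exact Sum.isLeft_iff.1 (σ ⟨v, h⟩).2
    · rw [τ_neg v h]
      rcases hw : φ (.inl v) with w | w
      · exact ⟨w, rfl⟩
      · exact (h (by simp [AV, hw])).elim
  have τ_inj : τ.Injective := by
    intro v w hvw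
    by_cases hv : v ∈ AV <;> by_cases hw : w ∈ AV
    · rw [τ_pos v hv, τ_pos w hw] at hvw
      have := σ.injective (Subtype.ext (Sum.inr_injective hvw))
      exact congrArg Subtype.val this
    · rw [τ_pos v hv, τ_neg w hw] at hvw
      cases hvw
    · rw [τ_neg v hv, τ_pos w hw] at hvw
      cases hvw
    · rw [τ_neg v hv, τ_neg w hw] at hvw
      exact Sum.inl_injective hvw
  have τ_surj : ∀ w, ∃ v, φ (τ v) = .inl w := by
    intro w
    rcases hz : φ.symm (.inl w) with v | e
    · have hz' : φ (.inl v) = .inl w := by rw [← hz, RelIso.apply_symm_apply]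
      refine ⟨v, ?_⟩
      rw [τ_neg v (by simp [AV, hz']), hz']
    · have hz' : φ (.inr e) = .inl w := by rw [← hz, RelIso.apply_symm_apply]
      have he : e ∈ AE := by simp [AE, hz']
      refine ⟨(σ.symm ⟨e, he⟩).1, ?_⟩
      rw [τ_pos _ (σ.symm ⟨e, he⟩).2]
      simpa using hz'
  have τ_adj : ∀ v w, X.Adj v w ↔ v ≠ w ∧
      ∃ u, (incidenceGraph X).Adj (τ v) u ∧ (incidenceGraph X).Adj (τ w) u := by
    intro v w
    constructor
    · intro hvw
      refine ⟨hvw.ne, ?_⟩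
      have hv := Sym2.mem_mk_left v w
      have hw := Sym2.mem_mk_right v w
      set e : X.edgeSet := ⟨s(v, w), hvw⟩ with he
      by_cases h : e ∈ AE
      · have hvA := (hmem (e := e) hv).2 h
        have hwA := (hmem (e := e) hw).2 h
        rw [τ_pos v hvA, τ_pos w hwA]
        -- The exchanged edge `e = vw` is matched with one of its ends, and the other end is then a
        -- common neighbour of `τ v` and `τ w`.
        have h3 := hσ (σ.symm ⟨e, h⟩)
        rw [Equiv.apply_symm_apply] at h3
        rcases Sym2.mem_iff.1 h3 with h4 | h4
        · have h5 : σ ⟨v, hvA⟩ = ⟨e, h⟩ := by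
            rw [← Equiv.eq_symm_apply]
            exact Subtype.ext h4.symm
          refine ⟨.inl w, ?_, hσ ⟨w, hwA⟩⟩
          rw [h5]
          exact hw
        · have h5 : σ ⟨w, hwA⟩ = ⟨e, h⟩ := by
            rw [← Equiv.eq_symm_apply]
            exact Subtype.ext h4.symm
          refine ⟨.inl v, hσ ⟨v, hvA⟩, ?_⟩
          rw [h5]
          exact hv
      · rw [τ_neg v (fun hA => h ((hmem (e := e) hv).1 hA)),
          τ_neg w (fun hA => h ((hmem (e := e) hw).1 hA))]
        exact ⟨.inr e, hv, hw⟩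
    · rintro ⟨hne, u, hv, hw⟩
      by_cases hvA : v ∈ AV <;> by_cases hwA : w ∈ AV
      · rw [τ_pos v hvA] at hv
        rw [τ_pos w hwA] at hw
        rcases u with x | x
        · have hxA : x ∈ AV := (hmem hv).2 (σ ⟨v, hvA⟩).2
          have hσne : (σ ⟨v, hvA⟩).1 ≠ (σ ⟨w, hwA⟩).1 := by
            intro h
            exact hne (congrArg Subtype.val (σ.injective (Subtype.ext h)))
          obtain ⟨e, e', -, h⟩ := hdeg x hxA
          have h1 := (h _).1 hv
          have h2 := (h _).1 hw
          have h3 := (h _).1 (hσ ⟨x, hxA⟩)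
          -- The distinct edges `σ v` and `σ w` are the only two at `x`, so `σ x` is one of them.
          -- Hence `x` is `v` or `w`, and one of the two edges joins `v` to `w`.
          have h4 : (σ ⟨x, hxA⟩).1 = (σ ⟨v, hvA⟩).1 ∨ (σ ⟨x, hxA⟩).1 = (σ ⟨w, hwA⟩).1 := by
            grind
          rw [adj_iff_exists_mem]
          refine ⟨hne, ?_⟩
          rcases h4 with h4 | h4
          · obtain rfl : x = v := congrArg Subtype.val (σ.injective (Subtype.ext h4))
            exact ⟨_, hw, hσ ⟨w, hwA⟩⟩
          · obtain rfl : x = w := congrArg Subtype.val (σ.injective (Subtype.ext h4))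
            exact ⟨_, hσ ⟨v, hvA⟩, hv⟩
        · exact hv.elim
      · rw [τ_pos v hvA] at hv
        rw [τ_neg w hwA] at hw
        rcases u with x | x
        exacts [hw.elim, hv.elim]
      · rw [τ_neg v hvA] at hv
        rw [τ_pos w hwA] at hw
        rcases u with x | x
        exacts [hv.elim, hw.elim]
      · rw [τ_neg v hvA] at hv
        rw [τ_neg w hwA] at hw
        exact adj_iff_incidenceGraph.2 ⟨hne, u, hv, hw⟩
  choose ψ hψ using τ_left
  refine ⟨⟨Equiv.ofBijective ψ ⟨fun v w h => ?_, fun w => ?_⟩, fun {v w} => ?_⟩⟩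
  · exact τ_inj (φ.injective (by rw [hψ, hψ, h]))
  · obtain ⟨v, hv⟩ := τ_surj w
    exact ⟨v, Sum.inl_injective ((hψ v).symm.trans hv)⟩
  · change Y.Adj (ψ v) (ψ w) ↔ _
    rw [adj_iff_incidenceGraph, τ_adj, ← hψ, ← hψ]
    refine and_congr (not_congr ⟨fun h => ?_, congrArg ψ⟩) ?_
    · exact τ_inj (φ.injective (by rw [hψ, hψ, h]))
    · rw [φ.surjective.exists]
      simp only [hadj]

instance [Finite V] : Finite (PathVert X) := by
  refine Finite.of_injective (fun x => match x with
    | .p v => (Sum.inl v : V ⊕ (V × X.edgeSet) ⊕ X.edgeSet)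
    | .q v e _ => .inr (.inl (v, e))
    | .r e => .inr (.inr e)) ?_
  rintro (v | ⟨v, e, h⟩ | e) (w | ⟨w, f, h'⟩ | f) H <;> simp at H ⊢ <;> exact H

/-- Finite graphs `X` and `Y` with isomorphic graphs `C_X` and `C_Y` are isomorphic. -/
theorem nonempty_iso_of_edgePathGraph [Finite V]
    (φ : edgePathGraph X ≃g edgePathGraph Y) : Nonempty (X ≃g Y) := by
  obtain ⟨f⟩ := nonempty_edgePathGraph_iso X
  obtain ⟨g⟩ := nonempty_edgePathGraph_iso Y
  obtain ⟨h⟩ := nonempty_iso_of_incidenceGraph (f.symm.trans (φ.trans g))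
  exact nonempty_iso_of_incidenceGraph h

end Cancel

/-! ### Automorphisms of `C_X` and `P_X` -/

section Automorphisms

variable {V : Type u} {X : SimpleGraph V}

/-- The vertex has exactly two neighbours. -/
def HasTwoNeighbors (X : SimpleGraph V) (v : V) : Prop :=
  ∃ x y, x ≠ y ∧ ∀ z, X.Adj v z ↔ z = x ∨ z = y

theorem HasTwoNeighbors.map {W : Type*} {Y : SimpleGraph W} (φ : X ≃g Y) {v : V}
    (h : HasTwoNeighbors X v) : HasTwoNeighbors Y (φ v) := by
  obtain ⟨x, y, hxy, h⟩ := h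
  refine ⟨φ x, φ y, φ.injective.ne hxy, fun z => ?_⟩
  obtain ⟨z, rfl⟩ := φ.surjective z
  rw [φ.map_adj_iff, h, φ.injective.eq_iff, φ.injective.eq_iff]

theorem edgePathGraph_adj_p {v : V} {z : PathVert X} :
    (edgePathGraph X).Adj (.p v) z ↔ ∃ e h, z = .q v e h := by
  constructor
  · rintro (h | h) <;> cases h
    exact ⟨_, _, rfl⟩
  · rintro ⟨e, h, rfl⟩
    exact .inl (.pq _ _ _)

theorem edgePathGraph_adj_r {e : X.edgeSet} {z : PathVert X} :
    (edgePathGraph X).Adj (.r e) z ↔ ∃ v h, z = .q v e h := by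
  constructor
  · rintro (h | h) <;> cases h
    exact ⟨_, _, rfl⟩
  · rintro ⟨v, h, rfl⟩
    exact .inl (.rq _ _ _)

theorem edgePathGraph_adj_q {v : V} {e : X.edgeSet} {h} {z : PathVert X} :
    (edgePathGraph X).Adj (.q v e h) z ↔ z = .p v ∨ z = .r e := by
  constructor
  · rintro (h | h) <;> cases h
    exacts [.inl rfl, .inr rfl]
  · rintro (rfl | rfl)
    exacts [.inr (.pq _ _ _), .inr (.rq _ _ _)]

theorem hasTwoNeighbors_q (v : V) (e : X.edgeSet) (h) :
    HasTwoNeighbors (edgePathGraph X) (.q v e h) :=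
  ⟨.p v, .r e, by simp, fun _ => edgePathGraph_adj_q⟩

theorem hasTwoNeighbors_r (e : X.edgeSet) : HasTwoNeighbors (edgePathGraph X) (.r e) := by
  obtain ⟨x, y, hxy, h⟩ := exists_ends e
  refine ⟨.q x e ((h x).2 (.inl rfl)), .q y e ((h y).2 (.inr rfl)), by simpa using hxy,
    fun z => ?_⟩
  rw [edgePathGraph_adj_r]
  constructor
  · rintro ⟨v, hv, rfl⟩
    rcases (h v).1 hv with rfl | rfl
    exacts [.inl rfl, .inr rfl]
  · rintro (rfl | rfl)
    exacts [⟨_, _, rfl⟩, ⟨_, _, rfl⟩]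

/-- The neighbours of `p_v` correspond to the edges at `v`, hence to the neighbours of `v`. -/
theorem HasTwoNeighbors.of_p {v : V} (h : HasTwoNeighbors (edgePathGraph X) (.p v)) :
    HasTwoNeighbors X v := by
  obtain ⟨a, b, hab, h⟩ := h
  obtain ⟨e, he, rfl⟩ := edgePathGraph_adj_p.1 ((h a).2 (.inl rfl))
  obtain ⟨f, hf, rfl⟩ := edgePathGraph_adj_p.1 ((h b).2 (.inr rfl))
  obtain ⟨e, he'⟩ := e
  obtain ⟨f, hf'⟩ := f
  obtain ⟨x, rfl⟩ : ∃ x, e = s(v, x) := he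
  obtain ⟨y, rfl⟩ : ∃ y, f = s(v, y) := hf
  refine ⟨x, y, ?_, fun z => ?_⟩
  · rintro rfl
    exact hab rfl
  · constructor
    · intro hz
      have := (h (.q v ⟨s(v, z), hz⟩ (Sym2.mem_mk_left _ _))).1
        (edgePathGraph_adj_p.2 ⟨_, _, rfl⟩)
      refine this.imp (fun h => ?_) (fun h => ?_) <;>
      · injection h with _ h
        exact Sym2.congr_right.1 (congrArg Subtype.val h)
    · rintro (rfl | rfl)
      exacts [he', hf']

/-- By the hypothesis the `p` are exactly the vertices that do not have two neighbours, so they are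
preserved. The `q` are their neighbours, and `r_e` is the neighbour of `q_{v,e}` other than `p_v`.
-/
theorem exists_maps_of_edgePathGraph (hX : ∀ v, ¬ HasTwoNeighbors X v)
    (Φ : edgePathGraph X ≃g edgePathGraph X) :
    ∃ (φ : V → V) (ρ : X.edgeSet → X.edgeSet), (∀ v, Φ (.p v) = .p (φ v)) ∧
      (∀ e, Φ (.r e) = .r (ρ e)) ∧ ∀ v e h, ∃ h', Φ (.q v e h) = .q (φ v) (ρ e) h' := by
  have hp : ∀ (Φ : edgePathGraph X ≃g edgePathGraph X) v, ∃ w, Φ (.p v) = .p w := by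
    intro Φ v
    have key : ¬ HasTwoNeighbors (edgePathGraph X) (Φ (.p v)) := by
      intro h
      have := h.map Φ.symm
      rw [RelIso.symm_apply_apply] at this
      exact hX v this.of_p
    revert key
    rcases Φ (.p v) with w | ⟨w, e, h⟩ | e
    · exact fun _ => ⟨w, rfl⟩
    · exact fun key => (key (hasTwoNeighbors_q _ _ _)).elim
    · exact fun key => (key (hasTwoNeighbors_r _)).elim
  have hq : ∀ v e h w, Φ (.p v) = .p w → ∃ f h', Φ (.q v e h) = .q w f h' := by
    intro v e h w hw
    have h1 : (edgePathGraph X).Adj (Φ (.p v)) (Φ (.q v e h)) :=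
      Φ.map_adj_iff.2 (edgePathGraph_adj_p.2 ⟨_, _, rfl⟩)
    rw [hw] at h1
    exact edgePathGraph_adj_p.1 h1
  have hr : ∀ e, ∃ f, Φ (.r e) = .r f := by
    intro e
    obtain ⟨x, y, -, h⟩ := exists_ends e
    obtain ⟨w, hw⟩ := hp Φ x
    obtain ⟨f, h', hf⟩ := hq x e ((h x).2 (.inl rfl)) w hw
    have h1 : (edgePathGraph X).Adj (Φ (.q x e ((h x).2 (.inl rfl)))) (Φ (.r e)) :=
      Φ.map_adj_iff.2 (edgePathGraph_adj_q.2 (.inr rfl))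
    rw [hf] at h1
    rcases edgePathGraph_adj_q.1 h1 with h2 | h2
    · rw [← hw] at h2
      cases Φ.injective h2
    · exact ⟨f, h2⟩
  choose φ hφ using hp Φ
  choose ρ hρ using hr
  refine ⟨φ, ρ, hφ, hρ, fun v e h => ?_⟩
  obtain ⟨f, h', hf⟩ := hq v e h _ (hφ v)
  have h1 : (edgePathGraph X).Adj (Φ (.q v e h)) (Φ (.r e)) :=
    Φ.map_adj_iff.2 (edgePathGraph_adj_q.2 (.inr rfl))
  rw [hf, hρ, edgePathGraph_adj_q] at h1
  obtain rfl : ρ e = f := by simpa using h1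
  exact ⟨h', hf⟩

theorem exists_pathMap_eq (hX : ∀ v, ¬ HasTwoNeighbors X v)
    (Φ : edgePathGraph X ≃g edgePathGraph X) : ∃ φ : X ≃g X, ∀ x, Φ x = pathMap φ x := by
  obtain ⟨φ, ρ, h1, h2, h3⟩ := exists_maps_of_edgePathGraph hX Φ
  obtain ⟨φ', ρ', h1', h2', h3'⟩ := exists_maps_of_edgePathGraph hX Φ.symm
  have hmem : ∀ {v : V} {e : X.edgeSet}, v ∈ (e : Sym2 V) → φ v ∈ (ρ e : Sym2 V) :=
    fun {v e} h => (h3 v e h).1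
  have hmem' : ∀ {v : V} {e : X.edgeSet}, v ∈ (e : Sym2 V) → φ' v ∈ (ρ' e : Sym2 V) :=
    fun {v e} h => (h3' v e h).1
  have l : ∀ v, φ' (φ v) = v := by
    intro v
    have := Φ.symm_apply_apply (.p v)
    rw [h1, h1'] at this
    simpa using this
  have r : ∀ v, φ (φ' v) = v := by
    intro v
    have := Φ.apply_symm_apply (.p v)
    rw [h1', h1] at this
    simpa using this
  have hadj : ∀ {v w}, X.Adj v w → X.Adj (φ v) (φ w) := by
    intro v w h
    obtain ⟨hne, e, hv, hw⟩ := adj_iff_exists_mem.1 h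
    refine adj_iff_exists_mem.2 ⟨fun h' => hne ?_, ρ e, hmem hv, hmem hw⟩
    rw [← l v, ← l w, h']
  have hadj' : ∀ {v w}, X.Adj v w → X.Adj (φ' v) (φ' w) := by
    intro v w h
    obtain ⟨hne, e, hv, hw⟩ := adj_iff_exists_mem.1 h
    refine adj_iff_exists_mem.2 ⟨fun h' => hne ?_, ρ' e, hmem' hv, hmem' hw⟩
    rw [← r v, ← r w, h']
  let ψ : X ≃g X := ⟨⟨φ, φ', l, r⟩, fun {v w} =>
    ⟨fun h => by simpa [l] using hadj' h, fun h => hadj h⟩⟩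
  have hψ : ∀ v, ψ v = φ v := fun _ => rfl
  -- An edge is determined by its two ends, and both edges contain the images of the ends of `e`.
  have hρ : ∀ e, ψ.mapEdgeSet e = ρ e := by
    intro e
    obtain ⟨x, y, hxy, h⟩ := exists_ends e
    refine Subtype.ext (Sym2.eq_of_ne_mem (ψ.injective.ne hxy)
      (mem_mapEdgeSet ψ ((h x).2 (.inl rfl))) (mem_mapEdgeSet ψ ((h y).2 (.inr rfl)))
      (hmem ((h x).2 (.inl rfl))) (hmem ((h y).2 (.inr rfl))))
  refine ⟨ψ, ?_⟩
  rintro (v | ⟨v, e, h⟩ | e)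
  · exact h1 v
  · obtain ⟨h', h4⟩ := h3 v e h
    rw [h4]
    simp only [pathMap, hρ, hψ]
  · rw [h2]
    simp only [pathMap, hρ]

/-- The action of the automorphisms of `X` on the poset `P_X`. -/
def pathOrderHom (X : SimpleGraph V) : (X ≃g X) →* (PathVert X ≃o PathVert X) where
  toFun := pathOrderIso
  map_one' := by
    ext x
    have h : ∀ e, (1 : X ≃g X).mapEdgeSet e = e := fun e =>
      Subtype.ext (congrFun Sym2.map_id e.1)
    cases x
    · rfl
    · change PathVert.q _ _ _ = PathVert.q _ _ _
      simp only [h]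
      rfl
    · exact congrArg PathVert.r (h _)
  map_mul' φ ψ := by
    ext x
    have h : ∀ e, (φ * ψ).mapEdgeSet e = φ.mapEdgeSet (ψ.mapEdgeSet e) := fun e =>
      Subtype.ext (Sym2.map_map (f := ψ) (g := φ) e.1).symm
    cases x
    · rfl
    · change PathVert.q _ _ _ = PathVert.q _ _ _
      simp only [h]
      rfl
    · exact congrArg PathVert.r (h _)

/-- The automorphisms of the poset `P_X` as automorphisms of the graph `C_X`. -/
def pathGraphHom (X : SimpleGraph V) :
    (PathVert X ≃o PathVert X) →* (edgePathGraph X ≃g edgePathGraph X) where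
  toFun := edgePathGraphIso
  map_one' := rfl
  map_mul' _ _ := rfl

theorem pathOrderHom_injective : Function.Injective (pathOrderHom X) := by
  intro φ ψ h
  refine RelIso.ext fun v => ?_
  have : pathMap φ (.p v) = pathMap ψ (.p v) := congrArg (fun f => f (PathVert.p v)) h
  simpa [pathMap] using this

theorem pathGraphHom_injective : Function.Injective (pathGraphHom X) := by
  intro φ ψ h
  refine RelIso.ext fun v => ?_
  exact congrArg (fun f => f v) h

/-- The composite decides both groups: since `pathGraphHom` is injective, `pathOrderHom` is
surjective as well. -/
theorem pathGraphHom_pathOrderHom_surjective (hX : ∀ v, ¬ HasTwoNeighbors X v) :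
    Function.Surjective (pathGraphHom X ∘ pathOrderHom X) := by
  intro Φ
  obtain ⟨φ, hφ⟩ := exists_pathMap_eq hX Φ
  exact ⟨φ, RelIso.ext fun x => (hφ x).symm⟩

/-- If no vertex of `X` has exactly two neighbours, then `C_X` has the automorphisms of `X`. -/
theorem nonempty_mulEquiv_edgePathGraph (hX : ∀ v, ¬ HasTwoNeighbors X v) :
    Nonempty ((edgePathGraph X ≃g edgePathGraph X) ≃* (X ≃g X)) :=
  ⟨(MulEquiv.ofBijective ((pathGraphHom X).comp (pathOrderHom X))
    ⟨pathGraphHom_injective.comp pathOrderHom_injective,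
      pathGraphHom_pathOrderHom_surjective hX⟩).symm⟩

/-- If no vertex of `X` has exactly two neighbours, then `P_X` has the automorphisms of `X`. -/
theorem nonempty_mulEquiv_pathVert (hX : ∀ v, ¬ HasTwoNeighbors X v) :
    Nonempty ((PathVert X ≃o PathVert X) ≃* (X ≃g X)) :=
  ⟨(MulEquiv.ofBijective (pathOrderHom X) ⟨pathOrderHom_injective,
    (pathGraphHom_pathOrderHom_surjective hX).of_comp_left pathGraphHom_injective⟩).symm⟩

end Automorphisms

/-! ### Graphs with a prescribed finite automorphism group and no vertex of degree two -/

section Frucht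

/-- The extra label `none`, which acts as multiplication by 1, guarantees two labels even for the
trivial group. -/
theorem exists_ne_label {G : Type*} [One G] (l : Option G) : ∃ l', l ≠ l' := by
  cases l
  · exact ⟨some 1, by simp⟩
  · exact ⟨none, by simp⟩

variable (G : Type) [Group G] [Finite G]

/-- The vertices of a graph whose automorphism group is `G`: two vertices for every group element
and every label, and two vertices for every colour (a label and a Boolean value). -/
inductive FruchtVert : Type
  | w (g : G) (l : Option G) (s : Bool)
  | t (i : Fin (Nat.card (Option G × Bool)))
  | leaf (i : Fin (Nat.card (Option G × Bool)))

/-- The numbering of the colours. -/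
noncomputable def colorEquiv : Option G × Bool ≃ Fin (Nat.card (Option G × Bool)) :=
  Finite.equivFin _

variable {G}

/-- The group element that determines the neighbour of the same label. -/
def fruchtBase (g : G) (l : Option G) : Bool → G
  | true => g
  | false => g * l.getD 1

/-- The adjacency relation of a graph whose automorphism group is `G`. -/
def fruchtAdj : FruchtVert G → FruchtVert G → Prop
  -- For fixed `g` and `s` the labels form a clique. Across the two sides, `(g, l, false)` is joined
  -- to `(g * l, l, true)`, the Cayley edge with label `l`.
  | .w g l s, .w g' l' s' => g = g' ∧ s = s' ∧ l ≠ l' ∨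
      l = l' ∧ s ≠ s' ∧ fruchtBase g l s = fruchtBase g' l' s'
  -- The colour of a vertex is encoded by how far its neighbours among the `t` reach.
  | .w _ l s, .t i => i ≤ colorEquiv G (l, s)
  | .t i, .w _ l s => i ≤ colorEquiv G (l, s)
  | .t i, .t j => i ≠ j
  | .t i, .leaf j => i = j
  | .leaf i, .t j => i = j
  | _, _ => False

variable (G) in
/-- A graph whose automorphism group is `G`. -/
def fruchtGraph : SimpleGraph (FruchtVert G) where
  Adj := fruchtAdj
  symm := ⟨by
    rintro (⟨g, l, s⟩ | i | i) (⟨g', l', s'⟩ | j | j) h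
    · exact h.imp (fun h => ⟨h.1.symm, h.2.1.symm, h.2.2.symm⟩)
        (fun h => ⟨h.1.symm, h.2.1.symm, h.2.2.symm⟩)
    · exact h
    · exact h
    · exact h
    · exact Ne.symm h
    · exact Eq.symm h
    · exact h
    · exact Eq.symm h
    · exact h⟩
  loopless := ⟨by
    rintro (⟨g, l, s⟩ | i | i) h
    · exact h.elim (fun h => h.2.2 rfl) (fun h => h.2.1 rfl)
    · exact h rfl
    · exact h⟩

instance : Finite (FruchtVert G) := by
  refine Finite.of_injective (fun x => match x with
    | .w g l s => (Sum.inl (g, l, s) : (G × Option G × Bool) ⊕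
        Fin (Nat.card (Option G × Bool)) ⊕ Fin (Nat.card (Option G × Bool)))
    | .t i => .inr (.inl i)
    | .leaf i => .inr (.inr i)) ?_
  rintro (⟨g, l, s⟩ | i | i) (⟨g', l', s'⟩ | j | j) H <;> simp at H ⊢ <;> exact H

theorem exists_adj_w (g : G) (l : Option G) (s : Bool) :
    ∃ l' g', (fruchtGraph G).Adj (.w g l s) (.w g l' s) ∧
      (fruchtGraph G).Adj (.w g l s) (.w g' l !s) := by
  obtain ⟨l', hl⟩ := exists_ne_label l
  cases s
  · exact ⟨l', g * l.getD 1, .inl ⟨rfl, rfl, hl⟩, .inr ⟨rfl, by simp, rfl⟩⟩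
  · exact ⟨l', g * (l.getD 1)⁻¹, .inl ⟨rfl, rfl, hl⟩,
      .inr ⟨rfl, by simp, by simp [fruchtBase]⟩⟩

theorem exists_adj_t (i : Fin (Nat.card (Option G × Bool))) :
    ∃ l s, colorEquiv G (l, s) = i ∧ (fruchtGraph G).Adj (.t i) (.w 1 l s) := by
  obtain ⟨⟨l, s⟩, h⟩ := (colorEquiv G).surjective i
  exact ⟨l, s, h, h.ge⟩

/-- A `w` has a neighbour with another label, one on the other side and one among the `t`; a `t` has
its leaf, a `w` and another `t`; a leaf has a single neighbour. -/
theorem not_hasTwoNeighbors_fruchtGraph (x : FruchtVert G) :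
    ¬ HasTwoNeighbors (fruchtGraph G) x := by
  rintro ⟨y, z, hyz, h⟩
  rcases x with ⟨g, l, s⟩ | i | i
  · obtain ⟨l', g', h1, h2⟩ := exists_adj_w g l s
    have h3 : (fruchtGraph G).Adj (.w g l s) (.t (colorEquiv G (l, s))) := le_refl _
    rw [h] at h1 h2 h3
    cases s <;> grind
  · obtain ⟨l, s, hi, h1⟩ := exists_adj_t i
    have h2 : (fruchtGraph G).Adj (.t i) (.leaf i) := rfl
    have h3 : (fruchtGraph G).Adj (.t i) (.t (colorEquiv G (l, !s))) := by
      change i ≠ _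
      rw [← hi]
      intro h
      have := (colorEquiv G).injective h
      simp at this
    rw [h] at h1 h2 h3
    grind
  · have h1 : ∀ z, (fruchtGraph G).Adj (.leaf i) z → z = .t i := by
      rintro (_ | j | _) h
      · exact h.elim
      · exact congrArg _ (Eq.symm h)
      · exact h.elim
    exact hyz ((h1 y ((h y).2 (.inl rfl))).trans (h1 z ((h z).2 (.inr rfl))).symm)

theorem isLeaf_fruchtGraph {x y : FruchtVert G} (h : ∀ z, (fruchtGraph G).Adj x z ↔ z = y) :
    ∃ i, x = .leaf i := by
  rcases x with ⟨g, l, s⟩ | i | i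
  · obtain ⟨l', g', h1, h2⟩ := exists_adj_w g l s
    rw [h] at h1 h2
    have := h1.trans h2.symm
    simp at this
  · obtain ⟨l, s, -, h1⟩ := exists_adj_t i
    have h2 : (fruchtGraph G).Adj (.t i) (.leaf i) := rfl
    rw [h] at h1 h2
    have := h1.trans h2.symm
    simp at this
  · exact ⟨i, rfl⟩

theorem adj_leaf_iff {i : Fin (Nat.card (Option G × Bool))} {z : FruchtVert G} :
    (fruchtGraph G).Adj (.leaf i) z ↔ z = .t i := by
  constructor
  · rcases z with _ | j | _ <;> intro h
    · exact h.elim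
    · exact congrArg _ (Eq.symm h)
    · exact h.elim
  · rintro rfl
    rfl

theorem exists_map_leaf (Φ : fruchtGraph G ≃g fruchtGraph G)
    (i : Fin (Nat.card (Option G × Bool))) :
    ∃ j, Φ (.leaf i) = .leaf j ∧ Φ (.t i) = .t j := by
  obtain ⟨j, hj⟩ := isLeaf_fruchtGraph (x := Φ (.leaf i)) (y := Φ (.t i)) (by
    intro z
    obtain ⟨z, rfl⟩ := Φ.surjective z
    rw [Φ.map_adj_iff, adj_leaf_iff, Φ.injective.eq_iff])
  refine ⟨j, hj, ?_⟩
  rw [← adj_leaf_iff, ← hj, Φ.map_adj_iff, adj_leaf_iff]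

theorem exists_map_w (Φ : fruchtGraph G ≃g fruchtGraph G) (g : G) (l : Option G) (s : Bool) :
    ∃ g' l' s', Φ (.w g l s) = .w g' l' s' := by
  rcases h : Φ (.w g l s) with ⟨g', l', s'⟩ | i | i
  · exact ⟨g', l', s', rfl⟩
  all_goals
    have h' := Φ.symm_apply_apply (.w g l s)
    rw [h] at h'
    obtain ⟨j, h1, h2⟩ := exists_map_leaf Φ.symm i
    simp [h1, h2] at h'

/-- The neighbourhoods of the `t` among the `w` decrease strictly with the index, because every
colour occurs. So the order of the indices can be read off from the graph. -/
theorem le_iff_fruchtGraph {i j : Fin (Nat.card (Option G × Bool))} :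
    i ≤ j ↔ ∀ (g : G) l s, (fruchtGraph G).Adj (.t j) (.w g l s) →
      (fruchtGraph G).Adj (.t i) (.w g l s) := by
  constructor
  · exact fun h g l s h' => h.trans h'
  · intro h
    obtain ⟨l, s, hj, h'⟩ := exists_adj_t j
    exact (h _ _ _ h').trans hj.le

theorem le_of_map_t (Φ : fruchtGraph G ≃g fruchtGraph G)
    {i j i' j' : Fin (Nat.card (Option G × Bool))} (hi : Φ (.t i) = .t i')
    (hj : Φ (.t j) = .t j') (h : i' ≤ j') : i ≤ j := by
  rw [le_iff_fruchtGraph] at h ⊢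
  intro g l s h1
  obtain ⟨g', l', s', h'⟩ := exists_map_w Φ g l s
  have := h g' l' s' (by rwa [← h', ← hj, Φ.map_adj_iff])
  rwa [← h', ← hi, Φ.map_adj_iff] at this

/-- The leaves are the only vertices of degree one and the `t` are their neighbours, so an
automorphism permutes the indices. It does so monotonically, and a strictly monotone self-map of
`Fin` satisfies `i ≤ π i`; with the inverse this leaves only the identity. -/
theorem map_leaf (Φ : fruchtGraph G ≃g fruchtGraph G) (i : Fin (Nat.card (Option G × Bool))) :
    Φ (.leaf i) = .leaf i ∧ Φ (.t i) = .t i := by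
  have key : ∀ (Φ : fruchtGraph G ≃g fruchtGraph G)
      (π : Fin (Nat.card (Option G × Bool)) → Fin (Nat.card (Option G × Bool))),
      (∀ i, Φ (.leaf i) = .leaf (π i) ∧ Φ (.t i) = .t (π i)) → ∀ i, i ≤ π i := by
    intro Φ π hπ i
    have : StrictMono π := by
      intro i j hij
      by_contra! h
      exact (le_of_map_t Φ (hπ j).2 (hπ i).2 h).not_gt hij
    exact this.le_apply
  choose π hπ using exists_map_leaf Φ
  choose π' hπ' using exists_map_leaf Φ.symm
  have h : π' (π i) = i := by
    have := Φ.symm_apply_apply (.t i)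
    rw [(hπ i).2, (hπ' _).2] at this
    simpa using this
  have h1 := key Φ π hπ i
  have h2 := key Φ.symm π' hπ' (π i)
  rw [h] at h2
  have h3 := hπ i
  rwa [le_antisymm h2 h1] at h3

theorem exists_map_w_eq (Φ : fruchtGraph G ≃g fruchtGraph G) (g : G) (l : Option G) (s : Bool) :
    ∃ g', Φ (.w g l s) = .w g' l s := by
  obtain ⟨g', l', s', h⟩ := exists_map_w Φ g l s
  have key : ∀ i, i ≤ colorEquiv G (l, s) ↔ i ≤ colorEquiv G (l', s') := by
    intro i
    have := Φ.map_adj_iff (v := .t i) (w := .w g l s)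
    rw [(map_leaf Φ i).2, h] at this
    exact this.symm
  have := (colorEquiv G).injective (le_antisymm ((key _).1 le_rfl) ((key _).2 le_rfl))
  obtain ⟨rfl, rfl⟩ := Prod.mk.inj this
  exact ⟨g', h⟩

variable (G) in
/-- The left translations. -/
def fruchtHom : G →* (fruchtGraph G ≃g fruchtGraph G) where
  toFun a :=
    { toFun := fun x => match x with
        | .w g l s => .w (a * g) l s
        | .t i => .t i
        | .leaf i => .leaf i
      invFun := fun x => match x with
        | .w g l s => .w (a⁻¹ * g) l s
        | .t i => .t i
        | .leaf i => .leaf i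
      left_inv := by rintro (_ | _ | _) <;> simp
      right_inv := by rintro (_ | _ | _) <;> simp
      map_rel_iff' := by
        have hb : ∀ (b g : G) l s, fruchtBase (b * g) l s = b * fruchtBase g l s := by
          intro b g l s
          cases s
          · exact mul_assoc _ _ _
          · rfl
        rintro (⟨g, l, s⟩ | i | i) (⟨g', l', s'⟩ | j | j) <;>
          simp [fruchtGraph, fruchtAdj, hb] }
  map_one' := by
    refine RelIso.ext ?_
    rintro (⟨g, l, s⟩ | i | i)
    · exact congrArg (fun g => FruchtVert.w g l s) (one_mul g)
    · rfl
    · rfl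
  map_mul' a b := by
    refine RelIso.ext ?_
    rintro (⟨g, l, s⟩ | i | i)
    · exact congrArg (fun g => FruchtVert.w g l s) (mul_assoc a b g)
    · rfl
    · rfl

/-- An automorphism fixes every `t`, hence preserves colours and changes only the group element. The
cliques make this change independent of the label, the edges labelled `none` make it equal on both
sides, and the edge labelled `g` that starts at 1 forces `f g = f 1 * g`, a left translation. -/
theorem fruchtHom_bijective : Function.Bijective (fruchtHom G) := by
  constructor
  · intro a b h
    have : FruchtVert.w (a * 1) none true = FruchtVert.w (b * 1) none true :=
      congrArg (fun f => f (FruchtVert.w 1 none true)) h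
    simpa using this
  · intro Φ
    choose f hf using exists_map_w_eq Φ
    have h1 : ∀ g l l' s, f g l s = f g l' s := by
      intro g l l' s
      by_cases hl : l = l'
      · rw [hl]
      · have := Φ.map_adj_iff.2 (show (fruchtGraph G).Adj (.w g l s) (.w g l' s) from
          .inl ⟨rfl, rfl, hl⟩)
        rw [hf, hf] at this
        rcases this with h | h
        · exact h.1
        · exact (hl h.1).elim
    have h2 : ∀ g l, f g l false * l.getD 1 = f (g * l.getD 1) l true := by
      intro g l
      have := Φ.map_adj_iff.2 (show (fruchtGraph G).Adj (.w g l false)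
        (.w (g * l.getD 1) l true) from .inr ⟨rfl, by simp, rfl⟩)
      rw [hf, hf] at this
      rcases this with h | h
      · exact (h.2.2 rfl).elim
      · exact h.2.2
    have h3 : ∀ g, f g none false = f g none true := by
      intro g
      simpa using h2 g none
    have h4 : ∀ g, f g none true = f 1 none true * g := by
      intro g
      have := h2 1 (some g)
      rw [h1 1 (some g) none, h1 _ (some g) none, h3] at this
      simpa using this.symm
    refine ⟨f 1 none true, RelIso.ext ?_⟩
    rintro (⟨g, l, s⟩ | i | i)
    · rw [hf]
      refine congrArg (fun g => FruchtVert.w g l s) ?_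
      rw [h1 g l none]
      cases s
      · rw [h3, h4 g]
      · rw [h4 g]
    · exact (map_leaf Φ i).2.symm
    · exact (map_leaf Φ i).1.symm

theorem nonempty_mulEquiv_fruchtGraph : Nonempty ((fruchtGraph G ≃g fruchtGraph G) ≃* G) :=
  ⟨(MulEquiv.ofBijective (fruchtHom G) fruchtHom_bijective).symm⟩

end Frucht

/-! ### The reductions and the universality statement -/

section Reductions

/-- An isomorphism of graphs induces an isomorphism of the incidence graphs. -/
def incidenceGraphIso {V W : Type*} {X : SimpleGraph V} {Y : SimpleGraph W} (φ : X ≃g Y) :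
    incidenceGraph X ≃g incidenceGraph Y where
  toEquiv := φ.toEquiv.sumCongr φ.mapEdgeSet
  map_rel_iff' := by
    have h : ∀ (v : V) (e : X.edgeSet),
        φ v ∈ (φ.mapEdgeSet e : Sym2 W) ↔ v ∈ (e : Sym2 V) := by
      refine fun v e => ⟨fun h => ?_, mem_mapEdgeSet φ⟩
      obtain ⟨w, hw, h⟩ := Sym2.mem_map.1 h
      rwa [← φ.injective h]
    rintro (v | e) (w | f)
    · exact Iff.rfl
    · exact h v f
    · exact h w e
    · exact Iff.rfl

theorem GraphCode.inDim_pathGraph (c : GraphCode) {k : ℕ} (hk : 4 ≤ k) :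
    InDim k c.pathGraph.graph :=
  c.nonempty_pathGraph_iso.elim fun φ => .of_iso φ (inDim_edgePathGraph hk)

theorem GraphCode.orderDim_pathPoset_le (c : GraphCode) {k : ℕ} (hk : 4 ≤ k) :
    orderDim c.pathPoset.Carrier ≤ k :=
  c.nonempty_pathPoset_iso.elim fun φ => (orderDim_congr φ).trans_le (orderDim_pathVert_le hk)

/-- Up to isomorphism `C_Y` is the threefold incidence graph of `X`, so the incidence graph is
cancelled three times. -/
theorem nonempty_iso_edgePathGraph_incidenceGraph_iff {V W : Type*} [Finite V]
    {X : SimpleGraph V} {Y : SimpleGraph W} :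
    Nonempty (X ≃g Y) ↔
      Nonempty (edgePathGraph (incidenceGraph X) ≃g edgePathGraph (incidenceGraph Y)) :=
  ⟨fun ⟨φ⟩ => ⟨edgePathGraphIso (pathOrderIso (incidenceGraphIso φ))⟩, fun ⟨φ⟩ =>
    (nonempty_iso_of_edgePathGraph φ).elim nonempty_iso_of_incidenceGraph⟩

theorem nonempty_iso_pathVert_incidenceGraph_iff {V W : Type*} [Finite V]
    {X : SimpleGraph V} {Y : SimpleGraph W} :
    Nonempty (X ≃g Y) ↔
      Nonempty (PathVert (incidenceGraph X) ≃o PathVert (incidenceGraph Y)) :=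
  ⟨fun ⟨φ⟩ => ⟨pathOrderIso (incidenceGraphIso φ)⟩, fun ⟨φ⟩ =>
    nonempty_iso_edgePathGraph_incidenceGraph_iff.2 ⟨edgePathGraphIso φ⟩⟩

theorem isPolyReduction_pathGraph {k : ℕ} (hk : 4 ≤ k) :
    IsPolyReduction graphIso (graphIsoDim k) (Prod.map GraphCode.pathGraph GraphCode.pathGraph) := by
  refine ⟨program.computable pathGadget fun _ => ⟨_, _, _, _, rfl, rfl⟩, fun I _ =>
    ⟨⟨I.1.inDim_pathGraph hk, I.2.inDim_pathGraph hk⟩,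
      nonempty_iso_edgePathGraph_incidenceGraph_iff.trans ?_⟩⟩
  obtain ⟨φ⟩ := I.1.nonempty_pathGraph_iso
  obtain ⟨ψ⟩ := I.2.nonempty_pathGraph_iso
  exact ⟨fun ⟨χ⟩ => ⟨(φ.trans χ).trans ψ.symm⟩, fun ⟨χ⟩ => ⟨(φ.symm.trans χ).trans ψ⟩⟩

theorem isPolyReduction_pathPoset {k : ℕ} (hk : 4 ≤ k) :
    IsPolyReduction graphIso (posetIsoDim k) (Prod.map GraphCode.pathPoset GraphCode.pathPoset) := by
  refine ⟨program.computable pathGadget fun _ => ⟨_, _, _, _, rfl, rfl⟩, fun I _ =>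
    ⟨⟨I.1.orderDim_pathPoset_le hk, I.2.orderDim_pathPoset_le hk⟩,
      nonempty_iso_pathVert_incidenceGraph_iff.trans ?_⟩⟩
  obtain ⟨φ⟩ := I.1.nonempty_pathPoset_iso
  obtain ⟨ψ⟩ := I.2.nonempty_pathPoset_iso
  exact ⟨fun ⟨χ⟩ => ⟨(φ.trans χ).trans ψ.symm⟩, fun ⟨χ⟩ => ⟨(φ.symm.trans χ).trans ψ⟩⟩

theorem isPolyReduction_cliqueCode (k : ℕ) :
    IsPolyReduction (posetIsoDim k) graphIso (Prod.map PosetCode.cliqueCode PosetCode.cliqueCode) := by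
  refine ⟨program.computable cliqueGadget fun _ => ⟨_, _, _, _, rfl, rfl⟩, fun I _ =>
    ⟨trivial, ?_⟩⟩
  obtain ⟨φ⟩ := I.1.nonempty_cliqueCode_iso
  obtain ⟨ψ⟩ := I.2.nonempty_cliqueCode_iso
  exact ⟨fun ⟨χ⟩ => ⟨(φ.trans (cliqueGraphIso χ)).trans ψ.symm⟩,
    fun ⟨χ⟩ => nonempty_orderIso_of_cliqueGraph ((φ.symm.trans χ).trans ψ)⟩

theorem polyReduces_graphIsoDim_graphIso (k : ℕ) : PolyReduces (graphIsoDim k) graphIso :=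
  ⟨id, ⟨Turing.idComputableInPolyTime _⟩, fun _ _ => ⟨trivial, Iff.rfl⟩⟩

/-- The vertices are to form a `Type`, whereas `G` may live in any universe; a finite group is
small, so it is replaced by `Shrink`. -/
theorem exists_inDim_mulEquiv {k : ℕ} (hk : 4 ≤ k) (G : Type*) [Group G] [Finite G] :
    ∃ (V : Type) (_ : Finite V) (X : SimpleGraph V), InDim k X ∧ Nonempty ((X ≃g X) ≃* G) ∧
      ∃ P : PartialOrder V, IsTransitiveOrientation X P ∧ orderDim V ≤ k ∧
        Nonempty ((V ≃o V) ≃* G) := by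
  obtain ⟨e⟩ := nonempty_mulEquiv_fruchtGraph (G := Shrink.{0} G)
  obtain ⟨f⟩ := nonempty_mulEquiv_edgePathGraph
    (not_hasTwoNeighbors_fruchtGraph (G := Shrink.{0} G))
  obtain ⟨g⟩ := nonempty_mulEquiv_pathVert (not_hasTwoNeighbors_fruchtGraph (G := Shrink.{0} G))
  exact ⟨PathVert (fruchtGraph (Shrink.{0} G)), inferInstance, edgePathGraph _,
    inDim_edgePathGraph hk, ⟨(f.trans e).trans Shrink.mulEquiv⟩, inferInstance,
    isTransitiveOrientation_edgePathOrder, orderDim_pathVert_le hk,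
    ⟨(g.trans e).trans Shrink.mulEquiv⟩⟩

end Reductions

end KDim

theorem mainTheorem2 :
    -- universality of comparability graphs, and of posets, of dimension at most `k`
    (∀ k : ℕ, 4 ≤ k → ∀ (G : Type*) [Group G] [Finite G],
      ∃ (V : Type) (_ : Finite V) (X : SimpleGraph V),
        KDim.InDim k X ∧ Nonempty ((X ≃g X) ≃* G) ∧
        ∃ P : PartialOrder V, KDim.IsTransitiveOrientation X P ∧ KDim.orderDim V ≤ k ∧
          Nonempty ((V ≃o V) ≃* G)) ∧
    -- GI-completeness
    (∀ k : ℕ, 4 ≤ k →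
      KDim.GIComplete (KDim.graphIsoDim k) ∧ KDim.GIComplete (KDim.posetIsoDim k)) ∧
    -- the reduction that replaces a graph `X` by `C_Y`, for the incidence graph `Y` of `X`
    (∃ f : KDim.GraphCode → KDim.GraphCode,
      (∀ c, Nonempty
        ((f c).graph ≃g KDim.edgePathGraph (KDim.incidenceGraph c.graph))) ∧
      ∀ k : ℕ, 4 ≤ k →
        KDim.IsPolyReduction KDim.graphIso (KDim.graphIsoDim k) (Prod.map f f)) ∧
    -- the reduction that replaces a graph `X` by the poset `P_Y`
    (∃ g : KDim.GraphCode → KDim.PosetCode,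
      (∀ c, Nonempty
        ((g c).Carrier ≃o KDim.PathVert (KDim.incidenceGraph c.graph))) ∧
      ∀ k : ℕ, 4 ≤ k →
        KDim.IsPolyReduction KDim.graphIso (KDim.posetIsoDim k) (Prod.map g g)) :=
  ⟨fun _ hk G _ _ => KDim.exists_inDim_mulEquiv hk G,
    fun k hk => ⟨⟨⟨_, KDim.isPolyReduction_pathGraph hk⟩, KDim.polyReduces_graphIsoDim_graphIso k⟩,
      ⟨_, KDim.isPolyReduction_pathPoset hk⟩, _, KDim.isPolyReduction_cliqueCode k⟩,
    ⟨KDim.GraphCode.pathGraph, KDim.GraphCode.nonempty_pathGraph_iso,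
      fun _ => KDim.isPolyReduction_pathGraph⟩,
    KDim.GraphCode.pathPoset, KDim.GraphCode.nonempty_pathPoset_iso,
      fun _ => KDim.isPolyReduction_pathPoset⟩
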